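/- Let $\Gamma$ be a cocompact, torsion-free, discrete subgroup of $\mathrm{Isom}_+(\mathbf H^3)$, let $\lambda>0$ be a real number and let $m\ge 1$ be an integer. Notation. The rank of a group is the minimal number of elements in a generating set. For a finite set $S$ of subgroups of $\Gamma$, the internal rank $\mathrm{IR}(S)$ is the maximum of the ranks of the subgroups $\langle T\rangle$ generated by the subgroups belonging to $T$, where $T$ ranges over all subsets of $S$. Let $\mathcal C_\lambda(\Gamma)$ be the set of maximal cyclic subgroups of $\Gamma$ that have a generator of translation length less than $\lambda$. For a maximal cyclic subgroup $C$ of $\Gamma$ let $$Z_\lambda(C)=\{P\in\mathbf H^3 : d(P,\gamma\cdot P)<\lambda \text{ for some } \gamma\in C\setminus\{1\}\},$$ and for $P\in\mathbf H^3$ let $S_\lambda(P,\Gamma)$ be the (finite) set of all maximal cyclic subgroups $C$ of $\Gamma$ with $P\in Z_\lambda(C)$. Let $\mathcal Z$ be the family $(Z_\lambda(C))_{C\in\mathcal C_\lambda(\Gamma)}$, and let $K$ be its nerve: the simplicial complex with vertex set $\mathcal C_\lambda(\Gamma)$ in which a nonempty finite set $\{C_0,\dots,C_d\}$ spans a simplex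 if and only if $Z_\lambda(C_0)\cap\dots\cap Z_\lambda(C_d)\neq\emptyset$. The internal rank of the simplex $\sigma$ with vertices $C_0,\dots,C_d$ is $\mathrm{IR}(\{C_0,\dots,C_d\})$. For an integer $n\ge 0$ let $K'_{(n)}$ denote the subcomplex of $K$ consisting of the simplices of internal rank at most $n$. The underlying space of a simplicial complex is given the weak topology (a set is open if and only if its intersection with every closed simplex is open in that simplex), and $\mathrm{link}_K(\sigma)$ is the subcomplex of all simplices of $K$ that have no vertex in common with $\sigma$ and are, together with $\sigma$, faces of a common simplex of $K$. Suppose that $\mathrm{IR}(S_\lambda(P,\Gamma))\ge m$ for every $P\in\mathbf H^3$. Then: 1. $\mathcal Z$ is a cover of $\mathbf H^3$ by hyperbolic cylinders: each $Z_\lambda(C)$ with $C\in\mathcal C_\lambda(\Gamma)$ is an open metric neighborhood, of positive radius, of a line in $\mathbf H^3$, and these sets cover $\mathbf H^3$. 2. $|K|$ is contractible. 3. For every simplex $\sigma$ of $K'_{(m-1)}$, $\mathrm{link}_K(\sigma)$ is contractible. 4. The subspace $|K|-|K'_{(m-1)}|$ of $|K|$ is contractible. -/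

import Mathlib

open scoped ENNReal Matrix

noncomputable section

/-! ### Hyperbolic 3-space (hyperboloid model) -/

/-- The Lorentz form on `ℝ⁴` of signature `(1, 3)`. -/
def lorentz (x y : Fin 4 → ℝ) : ℝ := x 0 * y 0 - ∑ i : Fin 3, x i.succ * y i.succ

/-- Hyperbolic 3-space: the upper sheet of the unit hyperboloid in `ℝ⁴`. -/
def HypSpace : Type := {x : Fin 4 → ℝ // lorentz x x = 1 ∧ 0 < x 0}

namespace HypSpace

theorem lorentz_eq (x y : Fin 4 → ℝ) :
    lorentz x y = x 0 * y 0 - (x 1 * y 1 + x 2 * y 2 + x 3 * y 3) := by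
  simp only [lorentz, Fin.sum_univ_three]
  rfl

theorem lorentz_comm (x y : Fin 4 → ℝ) : lorentz x y = lorentz y x := by
  simp only [lorentz_eq]; ring

theorem one_le_lorentz (x y : HypSpace) : 1 ≤ lorentz x.1 y.1 := by
  obtain ⟨x, hx, hx0⟩ := x
  obtain ⟨y, hy, hy0⟩ := y
  rw [lorentz_eq] at hx hy
  simp only [lorentz_eq]
  have hp : 0 < x 0 * y 0 := mul_pos hx0 hy0
  set s := x 1 * y 1 + x 2 * y 2 + x 3 * y 3 with hs
  have key : (1 + s) ^ 2 ≤ (x 0 * y 0) ^ 2 := by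
    have e1 : x 0 ^ 2 = 1 + x 1 ^ 2 + x 2 ^ 2 + x 3 ^ 2 := by linarith
    have e2 : y 0 ^ 2 = 1 + y 1 ^ 2 + y 2 ^ 2 + y 3 ^ 2 := by linarith
    rw [mul_pow, e1, e2, hs]
    nlinarith [sq_nonneg (x 1 - y 1), sq_nonneg (x 2 - y 2), sq_nonneg (x 3 - y 3),
      sq_nonneg (x 1 * y 2 - x 2 * y 1), sq_nonneg (x 1 * y 3 - x 3 * y 1),
      sq_nonneg (x 2 * y 3 - x 3 * y 2)]
  have := abs_le_of_sq_le_sq' key hp.le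
  linarith [this.2]

theorem eq_of_lorentz_eq_one (x y : HypSpace) (h : lorentz x.1 y.1 = 1) : x = y := by
  obtain ⟨x, hx, hx0⟩ := x
  obtain ⟨y, hy, hy0⟩ := y
  apply Subtype.ext
  rw [lorentz_eq] at hx hy
  simp only [lorentz_eq] at h
  have e1 : x 0 ^ 2 = 1 + x 1 ^ 2 + x 2 ^ 2 + x 3 ^ 2 := by linarith
  have e2 : y 0 ^ 2 = 1 + y 1 ^ 2 + y 2 ^ 2 + y 3 ^ 2 := by linarith
  have e3 : (x 0 * y 0) ^ 2 = (1 + (x 1 * y 1 + x 2 * y 2 + x 3 * y 3)) ^ 2 := by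
    congr 1; linarith
  rw [mul_pow, e1, e2] at e3
  have hz : (x 1 - y 1) ^ 2 + (x 2 - y 2) ^ 2 + (x 3 - y 3) ^ 2 + (x 1 * y 2 - x 2 * y 1) ^ 2
      + (x 1 * y 3 - x 3 * y 1) ^ 2 + (x 2 * y 3 - x 3 * y 2) ^ 2 = 0 := by linarith
  have q1 := sq_nonneg (x 1 - y 1)
  have q2 := sq_nonneg (x 2 - y 2)
  have q3 := sq_nonneg (x 3 - y 3)
  have q4 := sq_nonneg (x 1 * y 2 - x 2 * y 1)
  have q5 := sq_nonneg (x 1 * y 3 - x 3 * y 1)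
  have q6 := sq_nonneg (x 2 * y 3 - x 3 * y 2)
  have h1 : x 1 = y 1 := by
    have : (x 1 - y 1) ^ 2 = 0 := le_antisymm (by linarith) (sq_nonneg _)
    exact sub_eq_zero.1 (pow_eq_zero_iff two_ne_zero |>.1 this)
  have h2 : x 2 = y 2 := by
    have : (x 2 - y 2) ^ 2 = 0 := le_antisymm (by linarith) (sq_nonneg _)
    exact sub_eq_zero.1 (pow_eq_zero_iff two_ne_zero |>.1 this)
  have h3 : x 3 = y 3 := by
    have : (x 3 - y 3) ^ 2 = 0 := le_antisymm (by linarith) (sq_nonneg _)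
    exact sub_eq_zero.1 (pow_eq_zero_iff two_ne_zero |>.1 this)
  have h0 : x 0 = y 0 := by
    have : x 0 ^ 2 = y 0 ^ 2 := by rw [e1, e2, h1, h2, h3]
    exact (sq_eq_sq₀ hx0.le hy0.le).1 this
  funext i
  fin_cases i
  · exact h0
  · exact h1
  · exact h2
  · exact h3

/-- The form is negative semidefinite on the orthogonal complement of a point. -/
theorem lorentz_self_nonpos (y : HypSpace) (w : Fin 4 → ℝ) (hw : lorentz w y.1 = 0) :
    lorentz w w ≤ 0 := by
  obtain ⟨y, hy, hy0⟩ := y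
  rw [lorentz_eq] at hy hw
  rw [lorentz_eq]
  simp only at hw
  have e2 : y 0 ^ 2 = 1 + y 1 ^ 2 + y 2 ^ 2 + y 3 ^ 2 := by linarith
  have e3 : (w 0 * y 0) ^ 2 = (w 1 * y 1 + w 2 * y 2 + w 3 * y 3) ^ 2 := by
    congr 1; linarith
  have e4 : (w 0 * y 0) ^ 2 = w 0 ^ 2 * y 0 ^ 2 := by ring
  have hc : w 0 ^ 2 * y 0 ^ 2 ≤ (w 1 ^ 2 + w 2 ^ 2 + w 3 ^ 2) * y 0 ^ 2 := by
    rw [← e4, e3, e2]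
    nlinarith [sq_nonneg (w 1 * y 2 - w 2 * y 1), sq_nonneg (w 1 * y 3 - w 3 * y 1),
      sq_nonneg (w 2 * y 3 - w 3 * y 2), sq_nonneg (w 1), sq_nonneg (w 2), sq_nonneg (w 3)]
  have := le_of_mul_le_mul_right hc (by positivity)
  linarith

theorem lorentz_triangle (x y z : HypSpace) :
    (lorentz x.1 z.1 - lorentz x.1 y.1 * lorentz y.1 z.1) ^ 2 ≤
      (lorentz x.1 y.1 ^ 2 - 1) * (lorentz y.1 z.1 ^ 2 - 1) := by
  set p := lorentz x.1 y.1 with hp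
  set q := lorentz y.1 z.1 with hq
  set r := lorentz x.1 z.1 with hr
  have hx := x.2.1
  have hy := y.2.1
  have hz := z.2.1
  have key : ∀ t : ℝ, 0 ≤ (q ^ 2 - 1) * (t * t) + (2 * (p * q - r)) * t + (p ^ 2 - 1) := by
    intro t
    have h0 := lorentz_self_nonpos y (x.1 - p • y.1 + t • (z.1 - q • y.1)) (by
      have : lorentz (x.1 - p • y.1 + t • (z.1 - q • y.1)) y.1
          = lorentz x.1 y.1 - p * lorentz y.1 y.1
            + t * (lorentz y.1 z.1 - q * lorentz y.1 y.1) := by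
        simp only [lorentz_eq, Pi.add_apply, Pi.sub_apply, Pi.smul_apply, smul_eq_mul]; ring
      rw [this, hy, ← hp, ← hq]; ring)
    have e : lorentz (x.1 - p • y.1 + t • (z.1 - q • y.1)) (x.1 - p • y.1 + t • (z.1 - q • y.1))
        = lorentz x.1 x.1 - 2 * p * lorentz x.1 y.1 + p ^ 2 * lorentz y.1 y.1
          + 2 * t * (lorentz x.1 z.1 - q * lorentz x.1 y.1 - p * lorentz y.1 z.1
            + p * q * lorentz y.1 y.1)
          + t ^ 2 * (lorentz z.1 z.1 - 2 * q * lorentz y.1 z.1 + q ^ 2 * lorentz y.1 y.1) := by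
      simp only [lorentz_eq, Pi.add_apply, Pi.sub_apply, Pi.smul_apply, smul_eq_mul]; ring
    rw [e, hx, hy, hz, ← hp, ← hq, ← hr] at h0
    nlinarith
  have := discrim_le_zero key
  rw [discrim] at this
  nlinarith

/-- The hyperbolic metric: `cosh (d(x, y)) = ⟨x, y⟩`. -/
instance : MetricSpace HypSpace where
  dist x y := Real.arcosh (lorentz x.1 y.1)
  dist_self x := by
    rw [show lorentz x.1 x.1 = 1 from x.2.1]; simp
  dist_comm x y := by rw [lorentz_comm]
  dist_triangle x y z := by
    have hp := one_le_lorentz x y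
    have hq := one_le_lorentz y z
    have hr := one_le_lorentz x z
    have hn := add_nonneg (Real.arcosh_nonneg hp) (Real.arcosh_nonneg hq)
    rw [← Real.arcosh_cosh hn, Real.arcosh_le_arcosh (by linarith) (Real.cosh_pos _),
      Real.cosh_add, Real.cosh_arcosh hp, Real.cosh_arcosh hq, Real.sinh_arcosh hp,
      Real.sinh_arcosh hq, ← Real.sqrt_mul (by nlinarith)]
    have := Real.le_sqrt_of_sq_le (lorentz_triangle x y z)
    linarith
  eq_of_dist_eq_zero {x y} h :=
    eq_of_lorentz_eq_one x y ((Real.arcosh_eq_zero_iff (one_le_lorentz x y)).1 h)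

/-- The isometry group acts on hyperbolic space by evaluation. -/
instance : MulAction (HypSpace ≃ᵢ HypSpace) HypSpace where
  smul g x := g x
  one_smul _ := rfl
  mul_smul _ _ _ := rfl

/-- The compact-open topology on the isometry group. -/
instance : TopologicalSpace (HypSpace ≃ᵢ HypSpace) :=
  TopologicalSpace.induced (fun g => (⟨g, g.continuous⟩ : C(HypSpace, HypSpace))) inferInstance

/-- `Isom₊(ℍ³)`. Every isometry of the hyperboloid is the restriction of a unique linear
automorphism of `ℝ⁴`; it preserves orientation exactly when this automorphism has positive
determinant. -/
def isomPlus : Subgroup (HypSpace ≃ᵢ HypSpace) where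
  carrier := {g | ∃ A : Matrix (Fin 4) (Fin 4) ℝ, 0 < A.det ∧ ∀ x : HypSpace, (g x).1 = A *ᵥ x.1}
  mul_mem' := by
    rintro g h ⟨A, hA, hgA⟩ ⟨B, hB, hhB⟩
    refine ⟨A * B, by rw [Matrix.det_mul]; positivity, fun x => ?_⟩
    rw [IsometryEquiv.mul_apply, hgA, hhB, Matrix.mulVec_mulVec]
  one_mem' := ⟨1, by simp, fun x => by simp⟩
  inv_mem' := by
    rintro g ⟨A, hA, hgA⟩
    have hu : IsUnit A.det := hA.ne'.isUnit
    refine ⟨A⁻¹, by rw [Matrix.det_nonsing_inv, Ring.inverse_eq_inv]; positivity, fun x => ?_⟩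
    have h := hgA (g⁻¹ x)
    rw [IsometryEquiv.apply_inv_self] at h
    rw [h, Matrix.mulVec_mulVec, Matrix.nonsing_inv_mul _ hu, Matrix.one_mulVec]

/-- A (geodesic) line in hyperbolic space. -/
def IsLine (L : Set HypSpace) : Prop := ∃ f : ℝ → HypSpace, Isometry f ∧ L = Set.range f

/-- A hyperbolic cylinder: an open metric neighborhood, of positive radius, of a line. -/
def IsCylinder (Z : Set HypSpace) : Prop :=
  ∃ L, IsLine L ∧ ∃ r : ℝ, 0 < r ∧ Z = Metric.thickening r L

/-- The translation length `inf_P d(P, γ P)` of an isometry. -/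
def translationLength (g : HypSpace ≃ᵢ HypSpace) : ℝ := ⨅ P : HypSpace, dist P (g • P)

end HypSpace

/-! ### Ranks and internal ranks -/

/-- The rank of a group: the minimal cardinality of a generating set, `⊤` if the group is not
finitely generated. -/
def groupRank (G : Type*) [Group G] : ℕ∞ :=
  ⨅ (S : Finset G) (_ : Subgroup.closure (S : Set G) = ⊤), (S.card : ℕ∞)

/-- The internal rank of a set `S` of subgroups: the maximum (for finite `S`; in general the
supremum) of the ranks of the subgroups `⟨T⟩` generated by the subsets `T` of `S`. -/
def internalRank {G : Type*} [Group G] (S : Set (Subgroup G)) : ℕ∞ :=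
  ⨆ T ∈ 𝒫 S, groupRank (sSup T : Subgroup G)

theorem internalRank_mono {G : Type*} [Group G] {S S' : Set (Subgroup G)} (h : S ⊆ S') :
    internalRank S ≤ internalRank S' :=
  biSup_mono fun _ hT => Set.Subset.trans hT h

/-- `C` is a maximal cyclic subgroup. -/
def IsMaximalCyclic {G : Type*} [Group G] (C : Subgroup G) : Prop :=
  Maximal (fun D : Subgroup G => IsCyclic D) C

/-! ### Simplicial complexes, realizations, links, nerves -/

namespace PreAbstractSimplicialComplex

variable {ι : Type*}

/-- The geometric realization `|K|`, in barycentric coordinates: the open simplex spanned by a face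
`s` is the set of points whose support is exactly `s`. -/
def Realization (K : PreAbstractSimplicialComplex ι) : Type _ :=
  {x : ι →₀ ℝ // (∀ i, 0 ≤ x i) ∧ (x.sum fun _ a => a) = 1 ∧ x.support ∈ K.faces}

/-- The closed simplex of `|K|` spanned by the vertex set `s`. -/
def closedSimplex (K : PreAbstractSimplicialComplex ι) (s : Finset ι) : Set K.Realization :=
  {x | x.1.support ⊆ s}

/-- The weak topology on `|K|`: a set is open if and only if its intersection with each closed
simplex is open in the standard topology of that simplex (the one given by the finitely many
barycentric coordinates). -/
instance (K : PreAbstractSimplicialComplex ι) : TopologicalSpace K.Realization :=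
  ⨆ s ∈ K.faces, TopologicalSpace.coinduced (Subtype.val : K.closedSimplex s → K.Realization)
    (TopologicalSpace.induced (fun (x : K.closedSimplex s) (i : ι) => x.1.1 i)
      Pi.topologicalSpace)

/-- The subset `|L|` of `|K|`, for a subcomplex `L` of `K`. -/
def realizationOf (K L : PreAbstractSimplicialComplex ι) : Set K.Realization :=
  {x | x.1.support ∈ L.faces}

/-- The link of a simplex `σ` in `K`: the simplices without common vertices with `σ` that are,
together with `σ`, faces of a common simplex of `K`. -/
def link (K : PreAbstractSimplicialComplex ι) (σ : Finset ι) : PreAbstractSimplicialComplex ι where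
  faces := {τ | τ ∈ K.faces ∧ Disjoint τ σ ∧ ∃ φ ∈ K.faces, τ ⊆ φ ∧ σ ⊆ φ}
  isRelLowerSet_faces := by
    rintro τ ⟨hτ, hd, φ, hφ, h1, h2⟩
    refine ⟨(K.isRelLowerSet_faces hτ).1, fun t ht hne => ?_⟩
    exact ⟨(K.isRelLowerSet_faces hτ).2 ht hne, hd.mono_left ht, φ, hφ, ht.trans h1, h2⟩

/-- The abstract nerve of an indexed family of sets. -/
def nerve {X : Type*} (U : ι → Set X) : PreAbstractSimplicialComplex ι where
  faces := {s | s.Nonempty ∧ (⋂ i ∈ s, U i).Nonempty}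
  isRelLowerSet_faces := by
    rintro s ⟨hs, x, hx⟩
    refine ⟨hs, fun t ht hne => ⟨hne, x, ?_⟩⟩
    simp only [Set.mem_iInter] at hx ⊢
    exact fun i hi => hx i (ht hi)

/-- For a complex whose vertices `v` are labeled by subgroups `C v`: the subcomplex of the simplices
`σ` whose internal rank (that of `{C v | v ∈ σ}`) is at most `n`. -/
def rankSubcomplex {G : Type*} [Group G] (K : PreAbstractSimplicialComplex ι) (C : ι → Subgroup G)
    (n : ℕ) : PreAbstractSimplicialComplex ι where
  faces := {σ | σ ∈ K.faces ∧ internalRank (C '' (σ : Set ι)) ≤ n}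
  isRelLowerSet_faces := by
    rintro σ ⟨hσ, hr⟩
    refine ⟨(K.isRelLowerSet_faces hσ).1, fun t ht hne => ?_⟩
    exact ⟨(K.isRelLowerSet_faces hσ).2 ht hne,
      (internalRank_mono (Set.image_mono (Finset.coe_subset.2 ht))).trans hr⟩

end PreAbstractSimplicialComplex

/-! ### The cylinders of a group of isometries -/

namespace HypSpace

variable (Γ : Subgroup (HypSpace ≃ᵢ HypSpace))

/-- `𝒞_lam(Γ)`: the maximal cyclic subgroups of `Γ` with a generator of translation length
less than `lam`. -/
def shortCyclic (lam : ℝ) : Set (Subgroup Γ) :=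
  {C | IsMaximalCyclic C ∧ ∃ g : Γ, Subgroup.zpowers g = C ∧
    translationLength (g : HypSpace ≃ᵢ HypSpace) < lam}

/-- `Z_lam(C)`: the points displaced by less than `lam` by some nontrivial element of `C`. -/
def cylinder (lam : ℝ) (C : Subgroup Γ) : Set HypSpace :=
  {P | ∃ g ∈ C, g ≠ 1 ∧ dist P (g • P) < lam}

/-- `S_lam(P, Γ)`: the maximal cyclic subgroups of `Γ` having a nontrivial element that displaces
`P` by less than `lam`. -/
def shortAt (lam : ℝ) (P : HypSpace) : Set (Subgroup Γ) :=
  {C | IsMaximalCyclic C ∧ ∃ g ∈ C, g ≠ 1 ∧ dist P (g • P) < lam}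

/-- The nerve of the family `(Z_lam(C))`, indexed by `C ∈ 𝒞_lam(Γ)`. -/
def cylinderNerve (lam : ℝ) : PreAbstractSimplicialComplex (shortCyclic Γ lam) :=
  PreAbstractSimplicialComplex.nerve fun C => cylinder Γ lam C.1

/-- The subcomplex of the simplices of internal rank at most `n` of the nerve, each vertex of which
is labeled by the subgroup that it is. -/
def cylinderNerveLow (lam : ℝ) (n : ℕ) : PreAbstractSimplicialComplex (shortCyclic Γ lam) :=
  (cylinderNerve Γ lam).rankSubcomplex (fun C => C.1) n

end HypSpace

end

/-! In the hyperboloid model the cone in `ℝ⁴` over a tube around a line is, after a linear change of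
coordinates, the part of the future light cone satisfying a quadratic cone inequality, hence convex
and open (`convex_coneOver_tube`). The union of the cones over a cover of hyperbolic space is the
future cone, again convex, and passing to cones does not change the nerve (`nerve_coneOver`). All
three contractibility statements thus become statements about a locally finite family of open convex
sets in a real vector space with convex union.

They follow from one nerve theorem, `contractibleSpace_openPart_nerve`, which concerns a set `F` of
faces closed under enlargement and containing the set of all members through any given point. The
whole nerve is the case where `F` consists of all faces. The complement of the low-rank subcomplex
is the case of the faces of rank at least `m`, and the rank hypothesis says exactly that the members
through a point span such a face. The link of `σ` is the nerve of the sets `U i ∩ ⋂ j ∈ σ, U j` with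
`i ∉ σ`; if `σ` has rank below `m`, it cannot contain every member through a point, so these sets
cover the convex set `⋂ j ∈ σ, U j`.

For the nerve theorem, a map `f` from the union of the cover to `|K|` comes from bump functions, and
a map `g` back from averages of chosen points of intersections. Near the missing faces the small
barycentric coordinates must be ignored for `g` to be defined continuously; hence the truncation at
half of `height`. Straight-line homotopies join the identity to the truncation and the truncation to
`f ∘ g`, which factors through a contractible space.

The geometric input is that every nontrivial element of the group is a screw motion. Cocompactness
gives a point of minimal displacement (`exists_forall_dist_le`), and minimality makes the orbit of
that point run along a line (`exists_screw`). The displacement formula `ScrewData.cosh_dist_zpow`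
depends only on the distance to the axis, so each `Z_lam(C)` is a tube; proper discontinuity makes
the family locally finite (`finite_setOf_cylinder_inter_ball`). -/

open Filter Topology

/-! ### Continuous families of finitely supported weights -/

/-- A family of finitely supported functions depending continuously on a parameter, with locally
finite total support. -/
structure TameFamily {ι Y : Type*} [TopologicalSpace Y] (a : Y → ι →₀ ℝ) : Prop where
  continuous_apply : ∀ i, Continuous fun y => a y i
  locally_supported : ∀ y₀, ∃ N : Finset ι, ∀ᶠ y in 𝓝 y₀, (a y).support ⊆ N

namespace TameFamily

variable {ι Y Y' : Type*} [TopologicalSpace Y] [TopologicalSpace Y'] {a b : Y → ι →₀ ℝ}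

theorem comp (h : TameFamily a) {f : Y' → Y} (hf : Continuous f) : TameFamily (a ∘ f) where
  continuous_apply i := (h.continuous_apply i).comp hf
  locally_supported y₀ := by
    obtain ⟨N, hN⟩ := h.locally_supported (f y₀)
    exact ⟨N, hf.continuousAt.eventually hN⟩

theorem add (ha : TameFamily a) (hb : TameFamily b) : TameFamily (fun y => a y + b y) where
  continuous_apply i := (ha.continuous_apply i).add (hb.continuous_apply i)
  locally_supported y₀ := by
    classical
    obtain ⟨N, hN⟩ := ha.locally_supported y₀
    obtain ⟨M, hM⟩ := hb.locally_supported y₀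
    refine ⟨N ∪ M, ?_⟩
    filter_upwards [hN, hM] with y h1 h2
    exact Finsupp.support_add.trans (Finset.union_subset_union h1 h2)

theorem smul (ha : TameFamily a) {c : Y → ℝ} (hc : Continuous c) :
    TameFamily (fun y => c y • a y) where
  continuous_apply i := hc.mul (ha.continuous_apply i)
  locally_supported y₀ := by
    obtain ⟨N, hN⟩ := ha.locally_supported y₀
    refine ⟨N, ?_⟩
    filter_upwards [hN] with y h1
    exact Finsupp.support_smul.trans h1

theorem continuous_sum (ha : TameFamily a) : Continuous fun y => (a y).sum fun _ t => t := by
  rw [continuous_iff_continuousAt]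
  intro y₀
  obtain ⟨N, hN⟩ := ha.locally_supported y₀
  have : Continuous fun y => ∑ i ∈ N, a y i :=
    continuous_finsetSum _ fun i _ => ha.continuous_apply i
  refine this.continuousAt.congr ?_
  filter_upwards [hN] with y h1
  exact (Finsupp.sum_of_support_subset _ h1 (fun _ t => t) fun _ _ => rfl).symm

theorem of_support_subset {s : Finset ι} (h : ∀ i, Continuous fun y => a y i)
    (hs : ∀ y, (a y).support ⊆ s) : TameFamily a :=
  ⟨h, fun _ => ⟨s, Eventually.of_forall hs⟩⟩

end TameFamily

/-! ### The weak topology on unions of open simplices -/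

namespace PreAbstractSimplicialComplex

variable {ι : Type*} {K : PreAbstractSimplicialComplex ι} {Y Z : Type*} [TopologicalSpace Y]
  [TopologicalSpace Z]

theorem isOpen_realization_iff {A : Set K.Realization} :
    IsOpen A ↔ ∀ s ∈ K.faces, ∃ G : Set (ι → ℝ), IsOpen G ∧
      ∀ x : K.Realization, x.1.support ⊆ s → ((fun i => x.1 i) ∈ G ↔ x ∈ A) := by
  change IsOpen[⨆ s ∈ K.faces, _] A ↔ _
  simp only [isOpen_iSup_iff, isOpen_coinduced, isOpen_induced_iff]
  refine forall₂_congr fun s _ => exists_congr fun G => and_congr_right fun _ => ?_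
  rw [Set.ext_iff]
  exact ⟨fun h x hx => h ⟨x, hx⟩, fun h x => h x.1 x.2⟩

/-- A map into `|K|` with continuous barycentric coordinates and locally finite support is
continuous for the weak topology. -/
theorem continuous_of_tameFamily {h : Y → K.Realization} (ht : TameFamily fun y => (h y).1) :
    Continuous h := by
  classical
  rw [continuous_iff_continuousAt]
  intro y₀
  obtain ⟨N, hN⟩ := ht.locally_supported y₀
  rw [ContinuousAt, Filter.tendsto_def]
  intro A hA
  obtain ⟨B, hBA, hB, hyB⟩ := mem_nhds_iff.1 hA
  -- Only finitely many supports `s` occur near `y₀`, so each may be treated alone. If `s` misses a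
  -- vertex of the support of `h y₀`, that coordinate stays nonzero nearby and `s` does not occur;
  -- otherwise the comparison takes place in the closed simplex `s`.
  suffices hs : ∀ s ∈ N.powerset, ∀ᶠ y in 𝓝 y₀, (h y).1.support = s → y ∈ h ⁻¹' B by
    rw [← Finset.eventually_all] at hs
    filter_upwards [hs, hN] with y h1 h2
    exact hBA (h1 _ (Finset.mem_powerset.2 h2) rfl)
  intro s _
  by_cases hsK : s ∈ K.faces
  swap
  · exact Eventually.of_forall fun y hy => absurd (hy ▸ (h y).2.2.2) hsK
  by_cases hy₀ : (h y₀).1.support ⊆ s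
  · obtain ⟨G, hG, hGB⟩ := isOpen_realization_iff.1 hB s hsK
    have hc : Continuous fun y => (fun i => (h y).1 i) := continuous_pi ht.continuous_apply
    have : ∀ᶠ y in 𝓝 y₀, (fun i => (h y).1 i) ∈ G :=
      hc.continuousAt.eventually (hG.mem_nhds ((hGB _ hy₀).2 hyB))
    filter_upwards [this] with y h1 h2
    exact (hGB _ h2.le).1 h1
  · obtain ⟨i, hi, his⟩ := Finset.not_subset.1 hy₀
    have : ∀ᶠ y in 𝓝 y₀, (h y).1 i ≠ 0 :=
      (ht.continuous_apply i).continuousAt.eventually_ne (Finsupp.mem_support_iff.1 hi)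
    filter_upwards [this] with y h1 h2
    exact absurd (h2 ▸ Finsupp.mem_support_iff.2 h1) his

/-- `F` is a set of faces of `K` closed under passing to larger faces. -/
structure IsUpperFaces (K : PreAbstractSimplicialComplex ι) (F : Set (Finset ι)) : Prop where
  subset : F ⊆ K.faces
  upper : ∀ s ∈ F, ∀ t ∈ K.faces, s ⊆ t → t ∈ F

/-- The union of the open simplices of `|K|` spanned by the faces in `F`. -/
def openPart (K : PreAbstractSimplicialComplex ι) (F : Set (Finset ι)) : Set K.Realization :=
  {x | x.1.support ∈ F}

/-- The part of `openPart K F` lying in the closed simplex `s`, with the topology given by the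
barycentric coordinates. -/
def SimplexPart (K : PreAbstractSimplicialComplex ι) (F : Set (Finset ι)) (s : Finset ι) : Type _ :=
  {x : K.openPart F // x.1.1.support ⊆ s}

instance (F : Set (Finset ι)) (s : Finset ι) : TopologicalSpace (K.SimplexPart F s) :=
  TopologicalSpace.induced (fun x i => x.1.1.1 i) Pi.topologicalSpace

theorem continuous_simplexPart_apply {F : Set (Finset ι)} {s : Finset ι} (i : ι) :
    Continuous fun x : K.SimplexPart F s => x.1.1.1 i :=
  (continuous_apply i).comp continuous_induced_dom

variable {F : Set (Finset ι)}

/-- Since `F` is closed under enlargement, a support lies in `F` as soon as it contains some `t ∈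
F`, and nonvanishing of the coordinates in `t` is an open condition. -/
theorem IsUpperFaces.exists_isOpen (hF : K.IsUpperFaces F) (s : Finset ι) :
    ∃ G : Set (ι → ℝ), IsOpen G ∧ ∀ x : K.Realization, x.1.support ⊆ s →
      ((fun i => x.1 i) ∈ G ↔ x ∈ K.openPart F) := by
  refine ⟨⋃ t ∈ F, {v | ∀ i ∈ t, v i ≠ 0}, ?_, fun x _ => ?_⟩
  · refine isOpen_biUnion fun t _ => ?_
    have : {v : ι → ℝ | ∀ i ∈ t, v i ≠ 0} = ⋂ i ∈ t, {v | v i ≠ 0} := by ext; simp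
    rw [this]
    exact isOpen_biInter_finset fun i _ => isOpen_ne_fun (continuous_apply i) continuous_const
  · simp only [Set.mem_iUnion, Set.mem_ofPred_eq, exists_prop]
    constructor
    · rintro ⟨t, ht, h⟩
      exact hF.upper t ht _ x.2.2.2 fun i hi => Finsupp.mem_support_iff.2 (h i hi)
    · intro h
      exact ⟨_, h, fun i hi => Finsupp.mem_support_iff.1 hi⟩

theorem IsUpperFaces.isOpen_openPart (hF : K.IsUpperFaces F) : IsOpen (K.openPart F) :=
  isOpen_realization_iff.2 fun s _ => hF.exists_isOpen s

/-- An open subspace of a space with the weak topology is again coherent with its intersections with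
the closed simplices. -/
theorem IsUpperFaces.continuous_of_simplexPart (hF : K.IsUpperFaces F) {h : K.openPart F → Z}
    (hc : ∀ s, Continuous fun x : K.SimplexPart F s => h x.1) : Continuous h := by
  rw [continuous_def]
  intro W hW
  rw [hF.isOpen_openPart.isOpenEmbedding_subtypeVal.isOpen_iff_image_isOpen,
    isOpen_realization_iff]
  intro s _
  obtain ⟨G, hG, hG'⟩ := isOpen_induced_iff.1 ((hc s).isOpen_preimage W hW)
  obtain ⟨G₂, hG₂, hG₂'⟩ := hF.exists_isOpen s
  refine ⟨G ∩ G₂, hG.inter hG₂, fun x hx => ?_⟩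
  rw [Set.mem_inter_iff, hG₂' x hx]
  constructor
  · rintro ⟨h1, h2⟩
    refine ⟨⟨x, h2⟩, ?_, rfl⟩
    have : (⟨⟨x, h2⟩, hx⟩ : K.SimplexPart F s) ∈
        (fun x : K.SimplexPart F s => h x.1) ⁻¹' W := by rw [← hG']; exact h1
    exact this
  · rintro ⟨y, hy, rfl⟩
    refine ⟨?_, y.2⟩
    have : (⟨y, hx⟩ : K.SimplexPart F s) ∈ (fun x : K.SimplexPart F s => h x.1) ⁻¹' W := hy
    rw [← hG'] at this
    exact this

/-- A product with a coherent space need not be coherent, but for a locally compact factor currying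
reduces to continuity of a map into `C(Y, Z)`. It is needed for homotopies, with `Y` the unit
interval. -/
theorem IsUpperFaces.continuous_prod_of_simplexPart (hF : K.IsUpperFaces F)
    [LocallyCompactSpace Y] {h : K.openPart F × Y → Z}
    (hc : ∀ s, Continuous fun x : K.SimplexPart F s × Y => h (x.1.1, x.2)) : Continuous h := by
  have h1 : ∀ x : K.openPart F, Continuous fun t => h (x, t) := fun x =>
    let x' : K.SimplexPart F x.1.1.support := ⟨x, subset_rfl⟩
    (hc x.1.1.support).comp (Continuous.prodMk_right x')
  let c : K.openPart F → C(Y, Z) := fun x => ⟨fun t => h (x, t), h1 x⟩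
  have hcc : Continuous c := hF.continuous_of_simplexPart fun s =>
    ContinuousMap.continuous_of_continuous_uncurry _ (hc s)
  exact ContinuousMap.continuous_uncurry_of_continuous ⟨c, hcc⟩

theorem sum_pos_of_support_mem {a : ι →₀ ℝ} (h0 : ∀ i, 0 ≤ a i) (hs : a.support ∈ K.faces) :
    0 < a.sum fun _ t => t := by
  obtain ⟨i, hi⟩ := (K.isRelLowerSet_faces hs).1
  exact Finset.sum_pos' (fun i _ => h0 i)
    ⟨i, hi, (h0 i).lt_of_ne' (Finsupp.mem_support_iff.1 hi)⟩

/-- A nonnegative weight on the vertices, supported on a face, normalized to a point of `|K|`. -/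
noncomputable def normalize (K : PreAbstractSimplicialComplex ι) (a : ι →₀ ℝ) (h0 : ∀ i, 0 ≤ a i)
    (hs : a.support ∈ K.faces) : K.Realization :=
  have hpos := sum_pos_of_support_mem h0 hs
  ⟨(a.sum fun _ t => t)⁻¹ • a, fun i => mul_nonneg (inv_nonneg.2 hpos.le) (h0 i), by
    rw [Finsupp.sum_smul_index (by simp), Finsupp.sum, ← Finset.mul_sum]
    exact inv_mul_cancel₀ hpos.ne', by
    rwa [Finsupp.support_smul_eq (inv_ne_zero hpos.ne')]⟩

theorem normalize_support {a : ι →₀ ℝ} {h0 : ∀ i, 0 ≤ a i} {hs : a.support ∈ K.faces} :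
    (K.normalize a h0 hs).1.support = a.support :=
  Finsupp.support_smul_eq (inv_ne_zero (sum_pos_of_support_mem h0 hs).ne')

theorem normalize_self (x : K.Realization) : K.normalize x.1 x.2.1 x.2.2.2 = x := by
  apply Subtype.ext
  change (x.1.sum fun _ t => t)⁻¹ • x.1 = x.1
  rw [x.2.2.1, inv_one, one_smul]

theorem continuous_normalize {a : Y → ι →₀ ℝ} (ha : TameFamily a) (h0 : ∀ y i, 0 ≤ a y i)
    (hs : ∀ y, (a y).support ∈ K.faces) : Continuous fun y => K.normalize (a y) (h0 y) (hs y) :=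
  continuous_of_tameFamily <|
    ha.smul (ha.continuous_sum.inv₀ fun y => (sum_pos_of_support_mem (h0 y) (hs y)).ne')

/-- Nonnegative weights on the vertices whose support belongs to `F`. -/
def Weights (F : Set (Finset ι)) : Type _ := {a : ι →₀ ℝ // (∀ i, 0 ≤ a i) ∧ a.support ∈ F}

/-- The point of `openPart K F` given by a weight. -/
noncomputable def IsUpperFaces.point (hF : K.IsUpperFaces F) (a : Weights F) : K.openPart F :=
  ⟨K.normalize a.1 a.2.1 (hF.subset a.2.2), by
    change (K.normalize a.1 _ _).1.support ∈ F
    rw [normalize_support]; exact a.2.2⟩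

theorem IsUpperFaces.continuous_point (hF : K.IsUpperFaces F) {a : Y → Weights F}
    (ha : TameFamily fun y => (a y).1) : Continuous fun y => hF.point (a y) :=
  (continuous_normalize ha (fun y => (a y).2.1) (fun y => hF.subset (a y).2.2)).subtype_mk _

/-- Two weight-valued maps which are everywhere carried by a common face define homotopic maps. -/
theorem IsUpperFaces.homotopic_point [DecidableEq ι] (hF : K.IsUpperFaces F)
    {a b : K.openPart F → Weights F}
    (ha : ∀ s, TameFamily fun x : K.SimplexPart F s => (a x.1).1)
    (hb : ∀ s, TameFamily fun x : K.SimplexPart F s => (b x.1).1)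
    (hab : ∀ x, (a x).1.support ∪ (b x).1.support ∈ K.faces)
    (f g : C(K.openPart F, K.openPart F)) (hf : ∀ x, f x = hF.point (a x))
    (hg : ∀ x, g x = hF.point (b x)) : f.Homotopic g := by
  let c : K.openPart F × unitInterval → ι →₀ ℝ := fun p =>
    ((unitInterval.symm p.2 : unitInterval) : ℝ) • (a p.1).1 + (p.2 : ℝ) • (b p.1).1
  have c0 : ∀ p i, 0 ≤ c p i := fun p i =>
    add_nonneg (mul_nonneg (unitInterval.nonneg _) ((a p.1).2.1 i))
      (mul_nonneg (unitInterval.nonneg _) ((b p.1).2.1 i))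
  have e0 : ∀ x, c (x, 0) = (a x).1 := fun x => by simp [c]
  have e1 : ∀ x, c (x, 1) = (b x).1 := fun x => by simp [c]
  -- For `0 < t < 1` nonnegativity rules out cancellation, so the support is the union of both
  -- supports, a face above a member of `F`. At the ends it is the support of one weight alone.
  have cF : ∀ p, (c p).support ∈ F := by
    rintro ⟨x, t⟩
    rcases (unitInterval.nonneg t).eq_or_lt with h | h
    · have : t = 0 := Subtype.ext h.symm
      rw [this, e0]; exact (a x).2.2
    rcases (unitInterval.le_one t).eq_or_lt with h' | h'
    · have : t = 1 := Subtype.ext h'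
      rw [this, e1]; exact (b x).2.2
    have hsub : (c (x, t)).support = (a x).1.support ∪ (b x).1.support := by
      ext i
      have hA := (a x).2.1 i
      have hB := (b x).2.1 i
      have h1t : 0 < 1 - (t : ℝ) := by linarith
      simp only [Finset.mem_union, Finsupp.mem_support_iff, c, Finsupp.add_apply,
        Finsupp.smul_apply, smul_eq_mul, unitInterval.coe_symm_eq]
      rw [ne_eq, add_eq_zero_iff_of_nonneg (mul_nonneg h1t.le hA) (mul_nonneg h.le hB),
        mul_eq_zero, mul_eq_zero, or_iff_right h1t.ne', or_iff_right h.ne']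
      tauto
    rw [hsub]
    exact hF.upper _ (a x).2.2 _ (hab x) Finset.subset_union_left
  let H : K.openPart F × unitInterval → K.openPart F := fun p => hF.point ⟨c p, c0 p, cF p⟩
  have hH : Continuous H := by
    refine hF.continuous_prod_of_simplexPart fun s => hF.continuous_point ?_
    refine TameFamily.add ?_ ?_
    · exact ((ha s).comp continuous_fst).smul (by fun_prop)
    · exact ((hb s).comp continuous_fst).smul (by fun_prop)
  refine ⟨⟨⟨fun p => H (p.2, p.1), hH.comp continuous_swap⟩, fun x => ?_, fun x => ?_⟩⟩
  · rw [hf]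
    exact congrArg hF.point (Subtype.ext (e0 x))
  · rw [hg]
    exact congrArg hF.point (Subtype.ext (e1 x))

end PreAbstractSimplicialComplex

/-! ### The nerve theorem for open convex sets -/

theorem IsOpen.exists_continuous_pos_iff {E : Type*} [PseudoMetricSpace E] {U : Set E}
    (hU : IsOpen U) :
    ∃ f : E → ℝ, Continuous f ∧ (∀ x, 0 ≤ f x) ∧ ∀ x, 0 < f x ↔ x ∈ U := by
  by_cases h : Uᶜ.Nonempty
  · refine ⟨fun x => Metric.infDist x Uᶜ, Metric.continuous_infDist_pt _,
      fun x => Metric.infDist_nonneg, fun x => ?_⟩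
    rw [← hU.isClosed_compl.notMem_iff_infDist_pos h, Set.notMem_compl_iff]
  -- `Metric.infDist` to the empty set is `0` by convention, so the case where `U` is everything
  -- needs its own function.
  · refine ⟨fun _ => 1, continuous_const, fun _ => zero_le_one, fun x => ?_⟩
    have : x ∉ Uᶜ := fun hx => h ⟨x, hx⟩
    simpa using this

namespace PreAbstractSimplicialComplex

variable {ι : Type*} {K : PreAbstractSimplicialComplex ι} {F : Set (Finset ι)}

/-- Replaces an index set that varies with `y` by one fixed on the closed simplex `s`, so that
continuity can be read off termwise. -/
theorem sum_powerset_support {M : Type*} [AddCommMonoid M] {y : ι →₀ ℝ} {s : Finset ι}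
    (hs : y.support ⊆ s) {G : Finset ι → M} (hG : ∀ τ, (∃ i ∈ τ, y i = 0) → G τ = 0) :
    ∑ τ ∈ y.support.powerset, G τ = ∑ τ ∈ s.powerset, G τ := by
  refine Finset.sum_subset (Finset.powerset_mono.2 hs) fun τ _ hτ => hG τ ?_
  rw [Finset.mem_powerset, Finset.not_subset] at hτ
  simpa using hτ

open Classical in
/-- The product of the coordinates over `τ` if `τ ∈ F`, and `0` otherwise. -/
noncomputable def faceProd (F : Set (Finset ι)) (y : ι →₀ ℝ) (τ : Finset ι) : ℝ :=
  if τ ∈ F then ∏ i ∈ τ, y i else 0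

theorem faceProd_eq_zero {y : ι →₀ ℝ} {τ : Finset ι} (h : ∃ i ∈ τ, y i = 0) :
    faceProd F y τ = 0 := by
  obtain ⟨i, hi, h⟩ := h
  rw [faceProd, Finset.prod_eq_zero hi h, ite_self]

theorem faceProd_nonneg {y : ι →₀ ℝ} (h : ∀ i, 0 ≤ y i) (τ : Finset ι) :
    0 ≤ faceProd F y τ := by
  rw [faceProd]
  split_ifs
  exacts [Finset.prod_nonneg fun i _ => h i, le_rfl]

theorem faceProd_support_pos {y : ι →₀ ℝ} (h : ∀ i, 0 ≤ y i) (hy : y.support ∈ F) :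
    0 < faceProd F y y.support := by
  rw [faceProd, if_pos hy]
  exact Finset.prod_pos fun i hi => (h i).lt_of_ne' (Finsupp.mem_support_iff.1 hi)

/-- A continuous positive height such that the vertices of weight at least this height span a face
in `F`. -/
noncomputable def height (F : Set (Finset ι)) (y : ι →₀ ℝ) : ℝ :=
  (∑ τ ∈ y.support.powerset, faceProd F y τ ^ 2) / ∑ τ ∈ y.support.powerset, faceProd F y τ

theorem faceProd_sum_pos {y : ι →₀ ℝ} (h : ∀ i, 0 ≤ y i) (hy : y.support ∈ F) :
    0 < ∑ τ ∈ y.support.powerset, faceProd F y τ :=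
  Finset.sum_pos' (fun τ _ => faceProd_nonneg h τ)
    ⟨_, Finset.mem_powerset_self _, faceProd_support_pos h hy⟩

theorem height_pos {y : ι →₀ ℝ} (h : ∀ i, 0 ≤ y i) (hy : y.support ∈ F) : 0 < height F y :=
  div_pos (Finset.sum_pos' (fun _ _ => sq_nonneg _)
    ⟨_, Finset.mem_powerset_self _, pow_pos (faceProd_support_pos h hy) 2⟩)
    (faceProd_sum_pos h hy)

/-- The height is the average of the numbers `faceProd F y τ` weighted by themselves, so one of them
with positive weight is at least the height. Coordinates are at most `1`, so every factor of that
product is at least the product. -/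
theorem exists_height_le (x : K.openPart F) :
    ∃ τ ∈ F, ∀ i ∈ τ, height F x.1.1 ≤ x.1.1 i := by
  obtain ⟨⟨y, h0, h1, hK⟩, hy⟩ := x
  change y.support ∈ F at hy
  change ∃ τ ∈ F, ∀ i ∈ τ, height F y ≤ y i
  have hle : ∑ τ ∈ y.support.powerset, height F y * faceProd F y τ ≤
      ∑ τ ∈ y.support.powerset, faceProd F y τ ^ 2 := by
    rw [← Finset.mul_sum, height, div_mul_cancel₀ _ (faceProd_sum_pos h0 hy).ne']
  have hone : ∀ i, y i ≤ 1 := fun i => by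
    by_cases hi : i ∈ y.support
    · rw [← h1]
      exact Finset.single_le_sum (fun j _ => h0 j) hi
    · rw [Finsupp.notMem_support_iff.1 hi]; exact zero_le_one
  obtain ⟨τ, hτ, hpos, hle⟩ : ∃ τ ∈ y.support.powerset, 0 < faceProd F y τ ∧
      height F y ≤ faceProd F y τ := by
    by_contra! hcon
    refine hle.not_gt (Finset.sum_lt_sum (fun τ hτ => ?_)
      ⟨_, Finset.mem_powerset_self _, ?_⟩)
    · rcases (faceProd_nonneg (F := F) h0 τ).eq_or_lt with h | h
      · simp [← h]
      · rw [sq]; exact mul_le_mul_of_nonneg_right (hcon τ hτ h).le h.le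
    · have h := faceProd_support_pos h0 hy
      rw [sq]; exact mul_lt_mul_of_pos_right (hcon _ (Finset.mem_powerset_self _) h) h
  have hτF : τ ∈ F := by
    by_contra hcon
    rw [faceProd, if_neg hcon] at hpos
    exact lt_irrefl _ hpos
  refine ⟨τ, hτF, fun i hi => hle.trans ?_⟩
  classical
  rw [faceProd, if_pos hτF, ← Finset.mul_prod_erase _ _ hi]
  exact mul_le_of_le_one_right (h0 i) (Finset.prod_le_one (fun j _ => h0 j) fun j _ => hone j)

theorem continuous_faceProd {s : Finset ι} (τ : Finset ι) :
    Continuous fun x : K.SimplexPart F s => faceProd F x.1.1.1 τ := by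
  unfold faceProd
  split_ifs
  exacts [continuous_finsetProd _ fun i _ => continuous_simplexPart_apply i, continuous_const]

theorem continuous_height {s : Finset ι} :
    Continuous fun x : K.SimplexPart F s => height F x.1.1.1 := by
  have e : (fun x : K.SimplexPart F s => height F x.1.1.1) = fun x =>
      (∑ τ ∈ s.powerset, faceProd F x.1.1.1 τ ^ 2) / ∑ τ ∈ s.powerset, faceProd F x.1.1.1 τ := by
    funext x
    rw [height, sum_powerset_support x.2 fun τ h => faceProd_eq_zero h,
      sum_powerset_support x.2 fun τ h => by rw [faceProd_eq_zero h]; simp]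
  rw [e]
  refine (continuous_finsetSum _ fun τ _ => (continuous_faceProd τ).pow 2).div
    (continuous_finsetSum _ fun τ _ => continuous_faceProd τ) fun x => ?_
  rw [← sum_powerset_support x.2 fun τ h => faceProd_eq_zero h]
  exact (faceProd_sum_pos x.1.1.2.1 x.1.2).ne'

/-- Truncation of the weights at half the height. -/
noncomputable def truncate (F : Set (Finset ι)) (y : ι →₀ ℝ) : ι →₀ ℝ :=
  Finsupp.onFinset y.support (fun i => if y i = 0 then 0 else max (y i - height F y / 2) 0)
    fun _ hi => Finsupp.mem_support_iff.2 fun h => hi (if_pos h)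

theorem support_truncate_subset {y : ι →₀ ℝ} : (truncate F y).support ⊆ y.support :=
  Finsupp.support_onFinset_subset

theorem truncate_apply {y : ι →₀ ℝ} (h : ∀ i, 0 ≤ y i) (hy : y.support ∈ F) (i : ι) :
    truncate F y i = max (y i - height F y / 2) 0 := by
  have := height_pos h hy
  change (if y i = 0 then 0 else max (y i - height F y / 2) 0) = _
  split_ifs with h'
  · rw [h', max_eq_right]; linarith
  · rfl

theorem mem_truncate_support {y : ι →₀ ℝ} (h : ∀ i, 0 ≤ y i) (hy : y.support ∈ F) {i : ι} :
    i ∈ (truncate F y).support ↔ height F y / 2 < y i := by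
  rw [Finsupp.mem_support_iff, truncate_apply h hy, ne_eq, max_eq_right_iff, not_le, sub_pos]

theorem truncate_support_mem (hF : K.IsUpperFaces F) (x : K.openPart F) :
    (truncate F x.1.1).support ∈ F := by
  obtain ⟨τ, hτ, h⟩ := exists_height_le x
  have hsub : τ ⊆ (truncate F x.1.1).support := fun i hi =>
    (mem_truncate_support x.1.2.1 x.2).2
      (lt_of_lt_of_le (half_lt_self (height_pos x.1.2.1 x.2)) (h i hi))
  refine hF.upper τ hτ _ ?_ hsub
  exact (K.isRelLowerSet_faces x.1.2.2.2).2 support_truncate_subset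
    ((K.isRelLowerSet_faces (hF.subset hτ)).1.mono hsub)

/-- The truncated weights. -/
noncomputable def IsUpperFaces.truncation (hF : K.IsUpperFaces F) (x : K.openPart F) : Weights F :=
  ⟨truncate F x.1.1, fun i =>
    (le_max_right _ _).trans_eq (truncate_apply (F := F) x.1.2.1 x.2 i).symm,
    truncate_support_mem hF x⟩

theorem IsUpperFaces.tameFamily_truncation (hF : K.IsUpperFaces F) (s : Finset ι) :
    TameFamily fun x : K.SimplexPart F s => (hF.truncation x.1).1 := by
  refine TameFamily.of_support_subset (s := s) (fun i => ?_) fun x =>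
    support_truncate_subset.trans x.2
  have e : (fun x : K.SimplexPart F s => (hF.truncation x.1).1 i) =
      fun x => max (x.1.1.1 i - height F x.1.1.1 / 2) 0 :=
    funext fun x => truncate_apply x.1.1.2.1 x.1.2 i
  rw [e]
  exact ((continuous_simplexPart_apply i).sub (continuous_height.div_const 2)).max
    continuous_const

open Classical in
/-- A weight on the faces, positive only on faces in `F` that contain all vertices of weight more
than half the height. -/
noncomputable def carrierWeight (F : Set (Finset ι)) (y : ι →₀ ℝ) (τ : Finset ι) : ℝ :=
  faceProd F y τ * ∏ i ∈ y.support \ τ, max (1 - y i / (height F y / 2)) 0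

theorem carrierWeight_eq_zero {y : ι →₀ ℝ} {τ : Finset ι} (h : ∃ i ∈ τ, y i = 0) :
    carrierWeight F y τ = 0 := by
  rw [carrierWeight, faceProd_eq_zero h, zero_mul]

theorem carrierWeight_nonneg {y : ι →₀ ℝ} (h : ∀ i, 0 ≤ y i) (τ : Finset ι) :
    0 ≤ carrierWeight F y τ :=
  mul_nonneg (faceProd_nonneg h τ) (Finset.prod_nonneg fun _ _ => le_max_right _ _)

theorem mem_of_carrierWeight_ne_zero {y : ι →₀ ℝ} {τ : Finset ι} (h : carrierWeight F y τ ≠ 0) :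
    τ ∈ F := by
  by_contra hcon
  rw [carrierWeight, faceProd, if_neg hcon, zero_mul] at h
  exact h rfl

/-- A vertex outside `τ` with coordinate above half the height makes one factor of `carrierWeight F
y τ` vanish. -/
theorem truncate_support_subset {y : ι →₀ ℝ} (h : ∀ i, 0 ≤ y i) (hy : y.support ∈ F)
    {τ : Finset ι} (hτ : carrierWeight F y τ ≠ 0) : (truncate F y).support ⊆ τ := by
  classical
  intro i hi
  by_contra hiτ
  refine hτ ?_
  rw [mem_truncate_support h hy] at hi
  have hh := height_pos h hy
  rw [carrierWeight, Finset.prod_eq_zero (i := i), mul_zero]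
  · rw [Finset.mem_sdiff, Finsupp.mem_support_iff]
    exact ⟨(by linarith : 0 < y i).ne', hiτ⟩
  · rw [max_eq_right_iff, sub_nonpos, one_le_div (by linarith)]
    exact hi.le

theorem carrierWeight_sum_pos {y : ι →₀ ℝ} (h : ∀ i, 0 ≤ y i) (hy : y.support ∈ F) :
    0 < ∑ τ ∈ y.support.powerset, carrierWeight F y τ := by
  refine Finset.sum_pos' (fun τ _ => carrierWeight_nonneg h τ)
    ⟨_, Finset.mem_powerset_self _, ?_⟩
  classical
  rw [carrierWeight, Finset.sdiff_self, Finset.prod_empty, mul_one]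
  exact faceProd_support_pos h hy

theorem continuous_carrierWeight {s : Finset ι} (τ : Finset ι) :
    Continuous fun x : K.SimplexPart F s => carrierWeight F x.1.1.1 τ := by
  classical
  -- Vertices of `s` outside the support contribute the factor `max (1 - 0) 0 = 1`, so the product
  -- may run over a fixed set.
  have e : (fun x : K.SimplexPart F s => carrierWeight F x.1.1.1 τ) = fun x =>
      faceProd F x.1.1.1 τ *
        ∏ i ∈ s \ τ, max (1 - x.1.1.1 i / (height F x.1.1.1 / 2)) 0 := by
    funext x
    rw [carrierWeight]
    congr 1
    refine Finset.prod_subset (Finset.sdiff_subset_sdiff x.2 le_rfl) fun i hi hi' => ?_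
    have : x.1.1.1 i = 0 := by
      by_contra hne
      exact hi' (Finset.mem_sdiff.2
        ⟨Finsupp.mem_support_iff.2 hne, (Finset.mem_sdiff.1 hi).2⟩)
    rw [this]; simp
  rw [e]
  refine (continuous_faceProd τ).mul (continuous_finsetProd _ fun i _ => ?_)
  refine (continuous_const.sub ((continuous_simplexPart_apply i).div
    (continuous_height.div_const 2) fun x => ?_)).max continuous_const
  exact (half_pos (height_pos x.1.1.2.1 x.1.2)).ne'

variable {E : Type*} [NormedAddCommGroup E] [NormedSpace ℝ E] {U : ι → Set E}

/-- The weighted mean of the points `p τ` for the weights `carrierWeight`. -/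
noncomputable def mean (F : Set (Finset ι)) (p : Finset ι → E) (y : ι →₀ ℝ) : E :=
  y.support.powerset.centerMass (carrierWeight F y) p

/-- Every face `τ` of nonzero weight contains the support of the truncation, so all points entering
the average lie in the convex set `U i`. -/
theorem mean_mem (hconv : ∀ i, Convex ℝ (U i)) {p : Finset ι → E}
    (hp : ∀ τ ∈ F, ∀ i ∈ τ, p τ ∈ U i) {y : ι →₀ ℝ} (h : ∀ i, 0 ≤ y i) (hy : y.support ∈ F)
    {i : ι} (hi : i ∈ (truncate F y).support) : mean F p y ∈ U i := by
  classical
  rw [mean, ← Finset.centerMass_filter_ne_zero]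
  refine (hconv i).centerMass_mem (fun τ _ => carrierWeight_nonneg h τ) ?_ fun τ hτ => ?_
  · rw [Finset.sum_filter_ne_zero]
    exact carrierWeight_sum_pos h hy
  · have hne := (Finset.mem_filter.1 hτ).2
    exact hp τ (mem_of_carrierWeight_ne_zero hne) i (truncate_support_subset h hy hne hi)

theorem continuous_mean (p : Finset ι → E) {s : Finset ι} :
    Continuous fun x : K.SimplexPart F s => mean F p x.1.1.1 := by
  have e : (fun x : K.SimplexPart F s => mean F p x.1.1.1) = fun x =>
      (∑ τ ∈ s.powerset, carrierWeight F x.1.1.1 τ)⁻¹ •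
        ∑ τ ∈ s.powerset, carrierWeight F x.1.1.1 τ • p τ := by
    funext x
    rw [mean, Finset.centerMass, sum_powerset_support x.2 fun τ h => carrierWeight_eq_zero h,
      sum_powerset_support x.2 fun τ h => by rw [carrierWeight_eq_zero h, zero_smul]]
  rw [e]
  refine ((continuous_finsetSum _ fun τ _ => continuous_carrierWeight τ).inv₀ fun x => ?_).smul
    (continuous_finsetSum _ fun τ _ => (continuous_carrierWeight τ).smul continuous_const)
  rw [← sum_powerset_support x.2 fun τ h => carrierWeight_eq_zero h]
  exact (carrierWeight_sum_pos x.1.1.2.1 x.1.2).ne'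

/-- **Nerve theorem** for a locally finite family of open convex sets with convex union, and for a
set `F` of faces of the nerve containing the faces spanned by all the members through a point: the
union of the open simplices spanned by the faces in `F` is contractible. -/
theorem contractibleSpace_openPart_nerve (hopen : ∀ i, IsOpen (U i))
    (hconv : ∀ i, Convex ℝ (U i)) (hX : Convex ℝ (⋃ i, U i)) (hne : (⋃ i, U i).Nonempty)
    (hfin : ∀ x ∈ ⋃ i, U i, ∃ t ∈ 𝓝 x, {i | (U i ∩ t).Nonempty}.Finite)
    (hF : (nerve U).IsUpperFaces F)
    (hS : ∀ x ∈ ⋃ i, U i, ∀ s : Finset ι, (∀ i, i ∈ s ↔ x ∈ U i) → s ∈ F) :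
    ContractibleSpace ((nerve U).openPart F) := by
  classical
  choose φ φc φ0 φpos using fun i => (hopen i).exists_continuous_pos_iff
  have hsf : ∀ x : ⋃ i, U i, (Function.support fun i => φ i x).Finite := by
    intro x
    obtain ⟨t, ht, htf⟩ := hfin x x.2
    refine htf.subset fun i hi => ⟨x, ?_, mem_of_mem_nhds ht⟩
    exact (φpos i x).1 ((φ0 i x).lt_of_ne' hi)
  let a : (⋃ i, U i) → ι →₀ ℝ := fun x => Finsupp.ofSupportFinite (fun i => φ i x) (hsf x)
  have ha : ∀ x i, a x i = φ i x := fun _ _ => rfl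
  have hsupp : ∀ x i, i ∈ (a x).support ↔ (x : E) ∈ U i := fun x i => by
    rw [Finsupp.mem_support_iff, ha, ← φpos, (φ0 i x).lt_iff_ne']
  let w : (⋃ i, U i) → Weights F := fun x =>
    ⟨a x, fun i => φ0 i x, hS x x.2 _ (hsupp x)⟩
  have hw : TameFamily fun x => (w x).1 := by
    refine ⟨fun i => (φc i).comp continuous_subtype_val, fun x => ?_⟩
    obtain ⟨t, ht, htf⟩ := hfin x x.2
    refine ⟨htf.toFinset, ?_⟩
    filter_upwards [continuous_subtype_val.continuousAt.preimage_mem_nhds ht] with z hz i hi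
    exact htf.mem_toFinset.2 ⟨z, (hsupp z i).1 hi, hz⟩
  let f : C(⋃ i, U i, (nerve U).openPart F) := ⟨fun x => hF.point (w x), hF.continuous_point hw⟩
  -- The value `0` off `F` is harmless: such faces have zero weight in `mean`.
  have hp' : ∀ τ : Finset ι, ∃ p : E, τ ∈ F → ∀ i ∈ τ, p ∈ U i := fun τ => by
    by_cases hτ : τ ∈ F
    · obtain ⟨p, hp⟩ := (hF.subset hτ).2
      exact ⟨p, fun _ => by simpa using hp⟩
    · exact ⟨0, fun h => absurd h hτ⟩
  choose p hp using hp'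
  have hmem : ∀ (x : (nerve U).openPart F), ∀ i ∈ (truncate F x.1.1).support,
      mean F p x.1.1 ∈ U i := fun x i hi => mean_mem hconv hp x.1.2.1 x.2 hi
  have hgX : ∀ x : (nerve U).openPart F, mean F p x.1.1 ∈ ⋃ i, U i := fun x => by
    obtain ⟨i, hi⟩ := (hF.subset (truncate_support_mem hF x)).1
    exact Set.mem_iUnion.2 ⟨i, hmem x i hi⟩
  have hgs : ∀ s, Continuous fun x : (nerve U).SimplexPart F s =>
      (⟨mean F p x.1.1.1, hgX x.1⟩ : ⋃ i, U i) := fun s => (continuous_mean p).subtype_mk _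
  let g : C((nerve U).openPart F, ⋃ i, U i) :=
    ⟨fun x => ⟨mean F p x.1.1, hgX x⟩, hF.continuous_of_simplexPart hgs⟩
  let u : (nerve U).openPart F → Weights F := fun x => ⟨x.1.1, x.1.2.1, x.2⟩
  have hu : ∀ s, TameFamily fun x : (nerve U).SimplexPart F s => (u x.1).1 := fun s =>
    TameFamily.of_support_subset (s := s) (fun i => continuous_simplexPart_apply i) fun x => x.2
  let q : C((nerve U).openPart F, (nerve U).openPart F) :=
    ⟨fun x => hF.point (hF.truncation x), hF.continuous_of_simplexPart fun s =>
      hF.continuous_point (hF.tameFamily_truncation s)⟩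
  -- Truncation only shrinks the support, so a point and its truncation lie in a common closed
  -- simplex.
  have h1 : (ContinuousMap.id _).Homotopic q :=
    hF.homotopic_point hu hF.tameFamily_truncation
      (fun x => by
        have : (truncate F x.1.1).support ⊆ x.1.1.support := support_truncate_subset
        change x.1.1.support ∪ (truncate F x.1.1).support ∈ _
        rw [Finset.union_eq_left.2 this]; exact x.1.2.2.2)
      _ _ (fun x => Subtype.ext (normalize_self x.1).symm) fun x => rfl
  -- If `i` survives the truncation of `x`, then `g x ∈ U i`, so `i` also belongs to the support of
  -- `f (g x)`.
  have h2 : q.Homotopic (f.comp g) :=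
    hF.homotopic_point hF.tameFamily_truncation (b := fun x => w (g x))
      (fun s => hw.comp (hgs s))
      (fun x => by
        have : (truncate F x.1.1).support ⊆ (a (g x)).support := fun i hi =>
          (hsupp _ i).2 (hmem x i hi)
        change (truncate F x.1.1).support ∪ (a (g x)).support ∈ _
        rw [Finset.union_eq_right.2 this]
        exact hF.subset (w (g x)).2.2)
      _ _ (fun x => rfl) fun x => rfl
  have : ContractibleSpace (⋃ i, U i) := hX.contractibleSpace hne
  rw [contractible_iff_id_nullhomotopic]
  obtain ⟨z, hz⟩ := ((id_nullhomotopic (⋃ i, U i)).comp_right f).comp_left g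
  refine ⟨z, (h1.trans h2).trans ?_⟩
  simpa using hz

end PreAbstractSimplicialComplex

/-! ### The hyperboloid inside Minkowski space -/

namespace HypSpace

theorem lorentz_add_left (x y z : Fin 4 → ℝ) :
    lorentz (x + y) z = lorentz x z + lorentz y z := by
  simp only [lorentz_eq, Pi.add_apply]; ring

theorem lorentz_smul_left (c : ℝ) (x z : Fin 4 → ℝ) :
    lorentz (c • x) z = c * lorentz x z := by
  simp only [lorentz_eq, Pi.smul_apply, smul_eq_mul]; ring

theorem lorentz_add_right (x y z : Fin 4 → ℝ) :
    lorentz x (y + z) = lorentz x y + lorentz x z := by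
  simp only [lorentz_eq, Pi.add_apply]; ring

theorem lorentz_smul_right (c : ℝ) (x z : Fin 4 → ℝ) :
    lorentz x (c • z) = c * lorentz x z := by
  simp only [lorentz_eq, Pi.smul_apply, smul_eq_mul]; ring

theorem lorentz_sub_left (x y z : Fin 4 → ℝ) :
    lorentz (x - y) z = lorentz x z - lorentz y z := by
  simp only [lorentz_eq, Pi.sub_apply]; ring

theorem lorentz_sub_right (x y z : Fin 4 → ℝ) :
    lorentz x (y - z) = lorentz x y - lorentz x z := by
  simp only [lorentz_eq, Pi.sub_apply]; ring

theorem lorentz_zero_left (x : Fin 4 → ℝ) : lorentz 0 x = 0 := by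
  simp [lorentz_eq]

theorem continuous_lorentz {Y : Type*} [TopologicalSpace Y] {f g : Y → Fin 4 → ℝ}
    (hf : Continuous f) (hg : Continuous g) : Continuous fun y => lorentz (f y) (g y) := by
  simp only [lorentz_eq]
  fun_prop

theorem cosh_dist (x y : HypSpace) : Real.cosh (dist x y) = lorentz x.1 y.1 :=
  Real.cosh_arcosh (one_le_lorentz x y)

theorem dist_lt_iff {x y : HypSpace} {r : ℝ} (hr : 0 ≤ r) :
    dist x y < r ↔ lorentz x.1 y.1 < Real.cosh r := by
  rw [← cosh_dist, Real.cosh_lt_cosh, abs_of_nonneg dist_nonneg, abs_of_nonneg hr]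

theorem isometry_of_lorentz {f : HypSpace → HypSpace}
    (h : ∀ x y, lorentz (f x).1 (f y).1 = lorentz x.1 y.1) : Isometry f :=
  Isometry.of_dist_eq fun x y => congrArg Real.arcosh (h x y)

theorem lorentz_isometry {f : HypSpace → HypSpace} (hf : Isometry f) (x y : HypSpace) :
    lorentz (f x).1 (f y).1 = lorentz x.1 y.1 := by
  rw [← cosh_dist, ← cosh_dist, hf.dist_eq]

/-! ### Topology -/

/-- The point of hyperbolic space with given spatial coordinates. -/
noncomputable def ofSpatial (v : Fin 3 → ℝ) : HypSpace :=
  ⟨![√(1 + v 0 ^ 2 + v 1 ^ 2 + v 2 ^ 2), v 0, v 1, v 2], by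
    rw [lorentz_eq]
    have := Real.mul_self_sqrt (show 0 ≤ 1 + v 0 ^ 2 + v 1 ^ 2 + v 2 ^ 2 by positivity)
    simp only [Matrix.cons_val]
    rw [this]; ring, by
    simp only [Matrix.cons_val]
    positivity⟩

theorem ofSpatial_coe (x : HypSpace) : ofSpatial ![x.1 1, x.1 2, x.1 3] = x := by
  have hx := x.2.1
  rw [lorentz_eq] at hx
  apply Subtype.ext
  funext i
  fin_cases i
  · simp only [ofSpatial, Matrix.cons_val]
    rw [show 1 + x.1 1 ^ 2 + x.1 2 ^ 2 + x.1 3 ^ 2 = x.1 0 ^ 2 by linarith]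
    exact Real.sqrt_sq x.2.2.le
  all_goals rfl

/-- The distance to `f y₀` is `arcosh` of a continuous function of the coordinates and vanishes at
`y₀`. Thus the metric topology is compared with that of `ℝ⁴` without a chart. -/
theorem continuous_of_coe {Y : Type*} [TopologicalSpace Y] {f : Y → HypSpace}
    (hf : Continuous fun y => (f y).1) : Continuous f := by
  rw [continuous_iff_continuousAt]
  intro y₀
  rw [ContinuousAt, tendsto_iff_dist_tendsto_zero]
  have h1 : Continuous fun y => Real.arcosh (lorentz (f y).1 (f y₀).1) :=
    Real.continuousOn_arcosh.comp_continuous (continuous_lorentz hf continuous_const)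
      fun y => one_le_lorentz _ _
  have h2 := h1.tendsto y₀
  rw [(f y₀).2.1, Real.arcosh_zero] at h2
  exact h2

theorem apply_zero_eq_lorentz (x : HypSpace) : x.1 0 = lorentz x.1 (ofSpatial 0).1 := by
  simp [lorentz_eq, ofSpatial]

theorem continuous_ofSpatial : Continuous ofSpatial := by
  refine continuous_of_coe (continuous_pi fun i => ?_)
  fin_cases i <;> simp [ofSpatial] <;> fun_prop

theorem abs_apply_le (x : HypSpace) (i : Fin 4) : |x.1 i| ≤ x.1 0 := by
  have hx := x.2.1
  rw [lorentz_eq] at hx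
  refine abs_le_of_sq_le_sq ?_ x.2.2.le
  fin_cases i <;> simp <;> nlinarith [sq_nonneg (x.1 1), sq_nonneg (x.1 2), sq_nonneg (x.1 3)]

/-- The coordinate `x 0` is `cosh` of the distance to the base point and bounds all others, so a
closed ball lies in the image of a compact set of spatial coordinates. -/
instance : ProperSpace HypSpace := by
  refine ⟨fun x r => ?_⟩
  have hc : IsCompact (ofSpatial '' Metric.closedBall 0
      (Real.cosh (r + dist x (ofSpatial 0)))) :=
    (isCompact_closedBall _ _).image continuous_ofSpatial
  refine hc.of_isClosed_subset Metric.isClosed_closedBall fun y hy => ?_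
  refine ⟨_, ?_, ofSpatial_coe y⟩
  have h0 : y.1 0 ≤ Real.cosh (r + dist x (ofSpatial 0)) := by
    rw [apply_zero_eq_lorentz, ← cosh_dist, Real.cosh_le_cosh]
    have := dist_triangle y x (ofSpatial 0)
    rw [Metric.mem_closedBall] at hy
    exact abs_le_abs_of_nonneg dist_nonneg (by linarith)
  rw [mem_closedBall_zero_iff, pi_norm_le_iff_of_nonneg (Real.cosh_pos _).le]
  intro i
  fin_cases i
  exacts [(abs_apply_le y 1).trans h0, (abs_apply_le y 2).trans h0, (abs_apply_le y 3).trans h0]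

/-! ### Cones -/

/-- The open future light cone. -/
def futureCone : Set (Fin 4 → ℝ) := {x | 0 < x 0 ∧ 0 < lorentz x x}

theorem isOpen_futureCone : IsOpen futureCone :=
  (isOpen_lt continuous_const (continuous_apply 0)).inter
    (isOpen_lt continuous_const (continuous_lorentz continuous_id continuous_id))

/-- Radial projection of the future cone to the hyperboloid. -/
noncomputable def radialProj (x : futureCone) : HypSpace :=
  ⟨(√(lorentz x.1 x.1))⁻¹ • x.1, by
    rw [lorentz_smul_left, lorentz_smul_right, ← mul_assoc, ← mul_inv,
      Real.mul_self_sqrt x.2.2.le, inv_mul_cancel₀ x.2.2.ne'],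
    mul_pos (inv_pos.2 (Real.sqrt_pos.2 x.2.2)) x.2.1⟩

theorem continuous_radialProj : Continuous radialProj := by
  refine continuous_of_coe (Continuous.smul (f := fun x : futureCone => (√(lorentz x.1 x.1))⁻¹)
    (g := fun x => x.1) (Continuous.inv₀ ?_ fun x => ?_) continuous_subtype_val)
  · exact (continuous_lorentz continuous_subtype_val continuous_subtype_val).sqrt
  · exact (Real.sqrt_pos.2 x.2.2).ne'

theorem coe_mem_futureCone (x : HypSpace) : x.1 ∈ futureCone :=
  ⟨x.2.2, by rw [x.2.1]; exact one_pos⟩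

theorem radialProj_coe (x : HypSpace) : radialProj ⟨x.1, coe_mem_futureCone x⟩ = x := by
  apply Subtype.ext
  change (√(lorentz x.1 x.1))⁻¹ • x.1 = x.1
  rw [x.2.1, Real.sqrt_one, inv_one, one_smul]

/-- The cone over a subset of the hyperboloid. -/
def coneOver (A : Set HypSpace) : Set (Fin 4 → ℝ) :=
  {x | ∃ hx : x ∈ futureCone, radialProj ⟨x, hx⟩ ∈ A}

theorem isOpen_coneOver {A : Set HypSpace} (hA : IsOpen A) : IsOpen (coneOver A) := by
  have : coneOver A = Subtype.val '' (radialProj ⁻¹' A) := by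
    ext x
    constructor
    · rintro ⟨hx, h⟩; exact ⟨⟨x, hx⟩, h, rfl⟩
    · rintro ⟨⟨x, hx⟩, h, rfl⟩; exact ⟨hx, h⟩
  rw [this]
  exact isOpen_futureCone.isOpenMap_subtype_val _ (hA.preimage continuous_radialProj)

theorem coe_mem_coneOver {A : Set HypSpace} {x : HypSpace} : x.1 ∈ coneOver A ↔ x ∈ A := by
  constructor
  · rintro ⟨_, h⟩; rwa [radialProj_coe] at h
  · intro h; exact ⟨coe_mem_futureCone x, by rwa [radialProj_coe]⟩

/-- Second-order cones are convex. -/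
theorem convex_secondOrderCone {μ : ℝ} (hμ : 0 ≤ μ) :
    Convex ℝ {y : Fin 4 → ℝ | 0 < y 0 ∧ y 1 ^ 2 + μ * (y 2 ^ 2 + y 3 ^ 2) < y 0 ^ 2} := by
  have hadd : ∀ p q : Fin 4 → ℝ, (0 < p 0 ∧ p 1 ^ 2 + μ * (p 2 ^ 2 + p 3 ^ 2) < p 0 ^ 2) →
      (0 < q 0 ∧ q 1 ^ 2 + μ * (q 2 ^ 2 + q 3 ^ 2) < q 0 ^ 2) →
      0 < (p + q) 0 ∧ (p + q) 1 ^ 2 + μ * ((p + q) 2 ^ 2 + (p + q) 3 ^ 2) < (p + q) 0 ^ 2 := by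
    rintro p q ⟨hp0, hp⟩ ⟨hq0, hq⟩
    refine ⟨add_pos hp0 hq0, ?_⟩
    simp only [Pi.add_apply]
    have hcs : (p 1 * q 1 + μ * (p 2 * q 2 + p 3 * q 3)) ^ 2 ≤
        (p 1 ^ 2 + μ * (p 2 ^ 2 + p 3 ^ 2)) * (q 1 ^ 2 + μ * (q 2 ^ 2 + q 3 ^ 2)) := by
      have e : (p 1 ^ 2 + μ * (p 2 ^ 2 + p 3 ^ 2)) * (q 1 ^ 2 + μ * (q 2 ^ 2 + q 3 ^ 2)) -
          (p 1 * q 1 + μ * (p 2 * q 2 + p 3 * q 3)) ^ 2 =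
          μ * ((p 1 * q 2 - p 2 * q 1) ^ 2 + (p 1 * q 3 - p 3 * q 1) ^ 2) +
            μ ^ 2 * (p 2 * q 3 - p 3 * q 2) ^ 2 := by ring
      have : 0 ≤ μ * ((p 1 * q 2 - p 2 * q 1) ^ 2 + (p 1 * q 3 - p 3 * q 1) ^ 2) +
            μ ^ 2 * (p 2 * q 3 - p 3 * q 2) ^ 2 := by positivity
      linarith
    have hprod : (p 1 ^ 2 + μ * (p 2 ^ 2 + p 3 ^ 2)) * (q 1 ^ 2 + μ * (q 2 ^ 2 + q 3 ^ 2)) ≤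
        (p 0 * q 0) ^ 2 := by
      rw [mul_pow]
      exact mul_le_mul hp.le hq.le (by positivity) (by positivity)
    have := (abs_le_of_sq_le_sq' (hcs.trans hprod) (mul_pos hp0 hq0).le).2
    nlinarith
  have hsmul : ∀ (c : ℝ) (p : Fin 4 → ℝ), 0 < c →
      (0 < p 0 ∧ p 1 ^ 2 + μ * (p 2 ^ 2 + p 3 ^ 2) < p 0 ^ 2) →
      0 < (c • p) 0 ∧ (c • p) 1 ^ 2 + μ * ((c • p) 2 ^ 2 + (c • p) 3 ^ 2) < (c • p) 0 ^ 2 := by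
    rintro c p hc ⟨hp0, hp⟩
    simp only [Pi.smul_apply, smul_eq_mul]
    refine ⟨mul_pos hc hp0, ?_⟩
    have := mul_lt_mul_of_pos_left hp (pow_pos hc 2)
    linarith
  rw [convex_iff_forall_pos]
  intro p hp q hq a b ha hb _
  exact hadd _ _ (hsmul a p ha hp) (hsmul b q hb hq)

theorem convex_futureCone : Convex ℝ futureCone := by
  convert convex_secondOrderCone zero_le_one using 1
  ext x
  simp only [futureCone, Set.mem_ofPred_eq, lorentz_eq]
  refine and_congr_right fun _ => ?_
  constructor <;> intro h <;> linarith

/-- The squared hyperbolic sine of the distance to the axis `x₂ = x₃ = 0`. -/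
def axisSq (y : Fin 4 → ℝ) : ℝ := y 2 ^ 2 + y 3 ^ 2

/-- The cone over a tube around a line is convex. -/
theorem convex_coneOver_tube {τ : HypSpace → HypSpace} {S : Matrix (Fin 4) (Fin 4) ℝ}
    (hS : ∀ x : HypSpace, (τ x).1 = S *ᵥ x.1) {κ : ℝ} (hκ : 0 < κ) :
    Convex ℝ (coneOver {x | axisSq (τ x).1 < κ}) := by
  -- On the hyperboloid `y₀² - y₁² = 1 + axisSq y`, so `axisSq y < κ`, written as `κ⁻¹ * axisSq y <
  -- 1`, becomes the homogeneous inequality `y₁² + (1 + κ⁻¹) * axisSq y < y₀²`, which is unaffected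
  -- by scaling.
  have e : coneOver {x | axisSq (τ x).1 < κ} = futureCone ∩ (Matrix.mulVecLin S) ⁻¹'
      {y | 0 < y 0 ∧ y 1 ^ 2 + (1 + κ⁻¹) * (y 2 ^ 2 + y 3 ^ 2) < y 0 ^ 2} := by
    ext x
    simp only [coneOver, Set.mem_ofPred_eq, Set.mem_inter_iff, Set.mem_preimage,
      Matrix.mulVecLin_apply]
    rw [← exists_prop]
    refine exists_congr fun hx => ?_
    set z := radialProj ⟨x, hx⟩ with hz
    set t := √(lorentz x x) with ht
    have ht0 : 0 < t := Real.sqrt_pos.2 hx.2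
    have hxz : x = t • z.1 := by
      change x = t • (t⁻¹ • x)
      rw [smul_smul, mul_inv_cancel₀ ht0.ne', one_smul]
    rw [hxz, Matrix.mulVec_smul, ← hS]
    have h1 := (τ z).2.1
    have h2 := (τ z).2.2
    rw [lorentz_eq] at h1
    simp only [Pi.smul_apply, smul_eq_mul, axisSq]
    rw [← mul_lt_mul_iff_right₀ (pow_pos ht0 2)]
    have hk : ∀ a : ℝ, a < κ ↔ κ⁻¹ * a < 1 := fun a => by
      rw [inv_mul_lt_iff₀ hκ, mul_one]
    constructor
    · intro h
      have h' := (hk _).1 (lt_of_mul_lt_mul_left h (by positivity))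
      refine ⟨mul_pos ht0 h2, ?_⟩
      have := mul_lt_mul_of_pos_left h' (pow_pos ht0 2)
      nlinarith
    · rintro ⟨-, h⟩
      refine mul_lt_mul_of_pos_left ((hk _).2 ?_) (pow_pos ht0 2)
      have h3 : t ^ 2 * (κ⁻¹ * ((τ z).1 2 ^ 2 + (τ z).1 3 ^ 2)) < t ^ 2 * 1 := by nlinarith
      exact lt_of_mul_lt_mul_left h3 (by positivity)
  rw [e]
  exact convex_futureCone.inter ((convex_secondOrderCone (by positivity)).linear_preimage _)

end HypSpace

/-! ### Linear Lorentz maps and axes of isometries -/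

namespace HypSpace

/-- The complement of a timelike vector is negative definite. Cauchy–Schwarz bounds `(w 0 * y 0)²`
by the spatial norm of `w` squared times `y 0 ^ 2 - 1`, while the hypothesis bounds it below by the
same norm times `y 0 ^ 2`. -/
theorem eq_zero_of_lorentz_nonneg (y : HypSpace) {w : Fin 4 → ℝ} (hw : lorentz w y.1 = 0)
    (h : 0 ≤ lorentz w w) : w = 0 := by
  obtain ⟨y, hy, hy0⟩ := y
  rw [lorentz_eq] at hy hw h
  simp only at hw
  have e2 : y 0 ^ 2 = 1 + y 1 ^ 2 + y 2 ^ 2 + y 3 ^ 2 := by linarith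
  have e3 : w 0 ^ 2 * y 0 ^ 2 = (w 1 * y 1 + w 2 * y 2 + w 3 * y 3) ^ 2 := by
    rw [← mul_pow]; congr 1; linarith
  have hc : w 0 ^ 2 * y 0 ^ 2 ≤
      (w 1 ^ 2 + w 2 ^ 2 + w 3 ^ 2) * (y 1 ^ 2 + y 2 ^ 2 + y 3 ^ 2) := by
    rw [e3]
    nlinarith [sq_nonneg (w 1 * y 2 - w 2 * y 1), sq_nonneg (w 1 * y 3 - w 3 * y 1),
      sq_nonneg (w 2 * y 3 - w 3 * y 2)]
  have h' : (w 1 ^ 2 + w 2 ^ 2 + w 3 ^ 2) * y 0 ^ 2 ≤ w 0 ^ 2 * y 0 ^ 2 :=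
    mul_le_mul_of_nonneg_right (by linarith) (sq_nonneg _)
  have hz : w 1 ^ 2 + w 2 ^ 2 + w 3 ^ 2 ≤ 0 := by
    rw [e2] at h' hc; linarith
  have h1 : w 1 = 0 := by nlinarith [sq_nonneg (w 1), sq_nonneg (w 2), sq_nonneg (w 3)]
  have h2 : w 2 = 0 := by nlinarith [sq_nonneg (w 1), sq_nonneg (w 2), sq_nonneg (w 3)]
  have h3 : w 3 = 0 := by nlinarith [sq_nonneg (w 1), sq_nonneg (w 2), sq_nonneg (w 3)]
  have h0 : w 0 = 0 := by
    rw [h1, h2, h3] at hw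
    have : w 0 * y 0 = 0 := by linarith
    exact (mul_eq_zero.1 this).resolve_right hy0.ne'
  funext i
  fin_cases i
  exacts [h0, h1, h2, h3]

/-- The linear maps preserving the Lorentz form. -/
def IsLorentz (A : Matrix (Fin 4) (Fin 4) ℝ) : Prop :=
  ∀ x y, lorentz (A *ᵥ x) (A *ᵥ y) = lorentz x y

/-- The hyperboloid spans `ℝ⁴`, so a bilinear identity checked on it holds everywhere. The `√2` is
the time coordinate of the three points other than the base point. -/
theorem exists_eq_combination (x : Fin 4 → ℝ) : ∃ (b : Fin 4 → HypSpace) (c : Fin 4 → ℝ),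
    x = c 0 • (b 0).1 + c 1 • (b 1).1 + c 2 • (b 2).1 + c 3 • (b 3).1 := by
  refine ⟨![ofSpatial 0, ofSpatial (Pi.single 0 1), ofSpatial (Pi.single 1 1),
    ofSpatial (Pi.single 2 1)], ![x 0 - √2 * (x 1 + x 2 + x 3), x 1, x 2, x 3], ?_⟩
  have : (1 : ℝ) + 1 = 2 := by norm_num
  funext i
  fin_cases i <;> simp [ofSpatial, this]
  ring

theorem isLorentz_of_isometry {g : HypSpace → HypSpace} (hg : Isometry g)
    {A : Matrix (Fin 4) (Fin 4) ℝ} (hA : ∀ x, (g x).1 = A *ᵥ x.1) : IsLorentz A := by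
  intro x y
  obtain ⟨b, c, rfl⟩ := exists_eq_combination x
  obtain ⟨b', c', rfl⟩ := exists_eq_combination y
  simp only [Matrix.mulVec_add, Matrix.mulVec_smul, ← hA, lorentz_add_left, lorentz_add_right,
    lorentz_smul_left, lorentz_smul_right, lorentz_isometry hg]

theorem IsLorentz.isUnit_det {A : Matrix (Fin 4) (Fin 4) ℝ} (hA : IsLorentz A) :
    IsUnit A.det := by
  rw [isUnit_iff_ne_zero]
  intro h
  obtain ⟨v, hv, hAv⟩ := Matrix.exists_mulVec_eq_zero_iff.2 h
  refine hv ?_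
  have hz : ∀ y, lorentz v y = 0 := fun y => by rw [← hA, hAv, lorentz_zero_left]
  funext i
  have := hz (Pi.single i 1)
  fin_cases i <;> simpa [lorentz_eq] using this

theorem IsLorentz.inv {A : Matrix (Fin 4) (Fin 4) ℝ} (hA : IsLorentz A) : IsLorentz A⁻¹ := by
  intro x y
  rw [← hA, Matrix.mulVec_mulVec, Matrix.mulVec_mulVec, Matrix.mul_nonsing_inv _ hA.isUnit_det,
    Matrix.one_mulVec, Matrix.one_mulVec]

/-- Otherwise `-z` lies on the upper sheet and pairs with `y` to at least `1`. -/
theorem zero_lt_of_lorentz_pos {z : Fin 4 → ℝ} (hz : lorentz z z = 1) (y : HypSpace)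
    (h : 0 < lorentz z y.1) : 0 < z 0 := by
  by_contra! hcon
  have h0 : z 0 ≠ 0 := by
    intro h0
    rw [lorentz_eq, h0] at hz
    nlinarith [sq_nonneg (z 1), sq_nonneg (z 2), sq_nonneg (z 3)]
  have hneg : lorentz ((-1 : ℝ) • z) ((-1 : ℝ) • z) = 1 := by
    rw [lorentz_smul_left, lorentz_smul_right, hz]; norm_num
  have := one_le_lorentz ⟨(-1 : ℝ) • z, hneg, by
    simpa using lt_of_le_of_ne hcon h0⟩ y
  rw [lorentz_smul_left] at this
  linarith

/-- A linear map preserving the Lorentz form and mapping some point of the upper sheet to the upper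
sheet gives an isometry of hyperbolic space. -/
theorem IsLorentz.exists_isometryEquiv {T : Matrix (Fin 4) (Fin 4) ℝ} (hT : IsLorentz T)
    {x₀ y₀ : HypSpace} (h : T *ᵥ x₀.1 = y₀.1) :
    ∃ τ : HypSpace ≃ᵢ HypSpace, (∀ x, (τ x).1 = T *ᵥ x.1) ∧ ∀ x, (τ.symm x).1 = T⁻¹ *ᵥ x.1 := by
  have h' : T⁻¹ *ᵥ y₀.1 = x₀.1 := by
    rw [← h, Matrix.mulVec_mulVec, Matrix.nonsing_inv_mul _ hT.isUnit_det, Matrix.one_mulVec]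
  let f : HypSpace → HypSpace := fun x => ⟨T *ᵥ x.1, by rw [hT, x.2.1],
    zero_lt_of_lorentz_pos (by rw [hT, x.2.1]) y₀ (by
      rw [← h, hT]; exact one_pos.trans_le (one_le_lorentz _ _))⟩
  let f' : HypSpace → HypSpace := fun x => ⟨T⁻¹ *ᵥ x.1, by rw [hT.inv, x.2.1],
    zero_lt_of_lorentz_pos (by rw [hT.inv, x.2.1]) x₀ (by
      rw [← h', hT.inv]; exact one_pos.trans_le (one_le_lorentz _ _))⟩
  refine ⟨⟨⟨f, f', fun x => Subtype.ext ?_, fun x => Subtype.ext ?_⟩,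
    isometry_of_lorentz fun x y => hT _ _⟩, fun _ => rfl, fun _ => rfl⟩
  · change T⁻¹ *ᵥ (T *ᵥ x.1) = x.1
    rw [Matrix.mulVec_mulVec, Matrix.nonsing_inv_mul _ hT.isUnit_det, Matrix.one_mulVec]
  · change T *ᵥ (T⁻¹ *ᵥ x.1) = x.1
    rw [Matrix.mulVec_mulVec, Matrix.mul_nonsing_inv _ hT.isUnit_det, Matrix.one_mulVec]

/-! ### Lorentz frames -/

/-- A vector orthogonal to three given ones. -/
theorem exists_ne_zero_lorentz_eq_zero (a b c : Fin 4 → ℝ) :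
    ∃ v : Fin 4 → ℝ, v ≠ 0 ∧ lorentz v a = 0 ∧ lorentz v b = 0 ∧ lorentz v c = 0 := by
  let r : (Fin 4 → ℝ) → Fin 4 → ℝ := fun a => ![a 0, -a 1, -a 2, -a 3]
  let M : Matrix (Fin 4) (Fin 4) ℝ := Matrix.of ![r a, r b, r c, 0]
  have hM : M.det = 0 := Matrix.det_eq_zero_of_row_eq_zero 3 fun j => rfl
  obtain ⟨v, hv, h⟩ := Matrix.exists_mulVec_eq_zero_iff.2 hM
  have hr : ∀ a, lorentz v a = r a ⬝ᵥ v := fun a => by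
    simp [lorentz_eq, r, dotProduct, Fin.sum_univ_four]; ring
  exact ⟨v, hv, (hr a).trans (congrFun h 0), (hr b).trans (congrFun h 1),
    (hr c).trans (congrFun h 2)⟩

theorem exists_unit_lorentz_eq_zero (x : HypSpace) (b c : Fin 4 → ℝ) :
    ∃ v : Fin 4 → ℝ, lorentz v v = -1 ∧ lorentz v x.1 = 0 ∧ lorentz v b = 0 ∧ lorentz v c = 0 := by
  obtain ⟨v, hv, h0, h1, h2⟩ := exists_ne_zero_lorentz_eq_zero x.1 b c
  have hneg : lorentz v v < 0 := by
    by_contra! h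
    exact hv (eq_zero_of_lorentz_nonneg x h0 h)
  have hpos : 0 < -lorentz v v := by linarith
  refine ⟨(√(-lorentz v v))⁻¹ • v, ?_, ?_, ?_, ?_⟩
  · rw [lorentz_smul_left, lorentz_smul_right, ← mul_assoc, ← mul_inv,
      Real.mul_self_sqrt hpos.le]
    rw [inv_mul_eq_div, div_neg, div_self hneg.ne]
  all_goals rw [lorentz_smul_left]; simp [*]

/-- The composition of a translation of length `l` along the line `x₂ = x₃ = 0` and a rotation of
angle `θ` around this line. -/
noncomputable def screw (l θ : ℝ) : Matrix (Fin 4) (Fin 4) ℝ :=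
  !![Real.cosh l, Real.sinh l, 0, 0; Real.sinh l, Real.cosh l, 0, 0;
    0, 0, Real.cos θ, -Real.sin θ; 0, 0, Real.sin θ, Real.cos θ]

theorem screw_mul (l θ l' θ' : ℝ) : screw l θ * screw l' θ' = screw (l + l') (θ + θ') := by
  ext i j
  fin_cases i <;> fin_cases j <;>
    simp [screw, Matrix.mul_apply, Fin.sum_univ_four, Real.cosh_add, Real.sinh_add, Real.cos_add,
      Real.sin_add] <;> ring

theorem screw_zero : screw 0 0 = 1 := by
  ext i j
  fin_cases i <;> fin_cases j <;> simp [screw]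

/-- The displacement of a screw motion depends on the point only through its distance to the axis;
this is why the sets `Z_lam(C)` are round tubes despite the rotation. -/
theorem lorentz_screw (l θ : ℝ) (y : HypSpace) :
    lorentz y.1 (screw l θ *ᵥ y.1) =
      Real.cosh l + axisSq y.1 * (Real.cosh l - Real.cos θ) := by
  have h := y.2.1
  rw [lorentz_eq] at h ⊢
  simp [screw, Matrix.mulVec, dotProduct, Fin.sum_univ_four, axisSq]
  linear_combination Real.cosh l * h

theorem exists_cos_sin {a b : ℝ} (h : a ^ 2 + b ^ 2 = 1) :
    ∃ θ : ℝ, Real.cos θ = a ∧ Real.sin θ = b := by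
  have hn : ‖(⟨a, b⟩ : ℂ)‖ = 1 := by
    rw [Complex.norm_def, Complex.normSq_mk, Real.sqrt_eq_one]; linarith
  refine ⟨Complex.arg ⟨a, b⟩, ?_, ?_⟩
  · rw [Complex.cos_arg (by rw [← norm_pos_iff, hn]; exact one_pos), hn, div_one]
  · rw [Complex.sin_arg, hn, div_one]

/-- An orientation-preserving linear isometry with a pseudo-orthonormal frame whose first two
vectors span an invariant plane is conjugate to a screw motion. -/
theorem exists_conj_screw {A : Matrix (Fin 4) (Fin 4) ℝ} (hA : IsLorentz A) (hdet : 0 < A.det)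
    (P : HypSpace) {v : Fin 4 → ℝ} (hvv : lorentz v v = -1) (hPv : lorentz v P.1 = 0) {l : ℝ}
    (hAP : A *ᵥ P.1 = Real.cosh l • P.1 + Real.sinh l • v)
    (hAv : A *ᵥ v = Real.sinh l • P.1 + Real.cosh l • v) :
    ∃ (T : Matrix (Fin 4) (Fin 4) ℝ) (θ : ℝ), IsLorentz T ∧ T *ᵥ (ofSpatial 0).1 = P.1 ∧
      A * T = T * screw l θ := by
  -- The invariant plane of `P` and `v` is completed to a pseudo-orthonormal frame, whose vectors
  -- are the columns of `T`.
  obtain ⟨u, huu, huP, huv, -⟩ := exists_unit_lorentz_eq_zero P v v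
  obtain ⟨w, hww, hwP, hwv, hwu⟩ := exists_unit_lorentz_eq_zero P v u
  have hPP := P.2.1
  set p := P.1 with hp
  have hcs := Real.cosh_sq l
  let f : Fin 4 → Fin 4 → ℝ := ![p, v, u, w]
  let T : Matrix (Fin 4) (Fin 4) ℝ := Matrix.of fun i j => f j i
  have hTy : ∀ y, T *ᵥ y = y 0 • p + y 1 • v + y 2 • u + y 3 • w := fun y => by
    funext i
    simp [T, f, Matrix.mulVec, dotProduct, Fin.sum_univ_four]
    ring
  have hPv' : lorentz p v = 0 := by rw [lorentz_comm, hPv]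
  have huP' : lorentz p u = 0 := by rw [lorentz_comm, huP]
  have hwP' : lorentz p w = 0 := by rw [lorentz_comm, hwP]
  have huv' : lorentz v u = 0 := by rw [lorentz_comm, huv]
  have hwv' : lorentz v w = 0 := by rw [lorentz_comm, hwv]
  have hwu' : lorentz u w = 0 := by rw [lorentz_comm, hwu]
  have hT : IsLorentz T := fun x y => by
    simp only [hTy, lorentz_add_left, lorentz_add_right, lorentz_smul_left, lorentz_smul_right,
      hPP, hvv, huu, hww, hPv, hPv', huP, huP', hwP, hwP', huv, huv', hwv, hwv', hwu, hwu']
    rw [lorentz_eq]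
    ring
  have hexp : ∀ x, x = lorentz x p • p - lorentz x v • v - lorentz x u • u - lorentz x w • w := by
    intro x
    have hx : T *ᵥ (T⁻¹ *ᵥ x) = x := by
      rw [Matrix.mulVec_mulVec, Matrix.mul_nonsing_inv _ hT.isUnit_det, Matrix.one_mulVec]
    set y := T⁻¹ *ᵥ x
    rw [← hx, hTy]
    simp only [lorentz_add_left, lorentz_smul_left,
      hPP, hvv, huu, hww, hPv, hPv', huP, huP', hwP, hwP', huv, huv', hwv, hwv', hwu, hwu']
    module
  -- images of `u` and `w` are orthogonal to the invariant plane
  have horth : ∀ z, lorentz z p = 0 → lorentz z v = 0 →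
      lorentz (A *ᵥ z) p = 0 ∧ lorentz (A *ᵥ z) v = 0 := by
    intro z h1 h2
    have e1 : lorentz (A *ᵥ z) (A *ᵥ p) = 0 := by rw [hA, h1]
    have e2 : lorentz (A *ᵥ z) (A *ᵥ v) = 0 := by rw [hA, h2]
    rw [hAP, lorentz_add_right, lorentz_smul_right, lorentz_smul_right] at e1
    rw [hAv, lorentz_add_right, lorentz_smul_right, lorentz_smul_right] at e2
    constructor
    · linear_combination Real.cosh l * e1 - Real.sinh l * e2 - lorentz (A *ᵥ z) p * hcs
    · linear_combination Real.cosh l * e2 - Real.sinh l * e1 - lorentz (A *ᵥ z) v * hcs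
  obtain ⟨hu1, hu2⟩ := horth u huP huv
  obtain ⟨hw1, hw2⟩ := horth w hwP hwv
  have hAu := hexp (A *ᵥ u)
  have hAw := hexp (A *ᵥ w)
  rw [hu1, hu2] at hAu
  rw [hw1, hw2] at hAw
  set a := -lorentz (A *ᵥ u) u with ha
  set b := -lorentz (A *ᵥ u) w with hb
  set d := -lorentz (A *ᵥ w) u with hd
  set e := -lorentz (A *ᵥ w) w with he
  replace hAu : A *ᵥ u = a • u + b • w := by rw [hAu, ha, hb]; module
  replace hAw : A *ᵥ w = d • u + e • w := by rw [hAw, hd, he]; module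
  have n1 : a ^ 2 + b ^ 2 = 1 := by
    have h := hA u u
    rw [hAu] at h
    simp only [lorentz_add_left, lorentz_add_right, lorentz_smul_left, lorentz_smul_right,
      huu, hww, hwu, hwu'] at h
    linarith
  have n2 : d ^ 2 + e ^ 2 = 1 := by
    have h := hA w w
    rw [hAw] at h
    simp only [lorentz_add_left, lorentz_add_right, lorentz_smul_left, lorentz_smul_right,
      huu, hww, hwu, hwu'] at h
    linarith
  have n3 : a * d + b * e = 0 := by
    have h := hA u w
    rw [hAu, hAw] at h
    simp only [lorentz_add_left, lorentz_add_right, lorentz_smul_left, lorentz_smul_right,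
      huu, hww, hwu, hwu'] at h
    linarith
  let R : Matrix (Fin 4) (Fin 4) ℝ :=
    !![Real.cosh l, Real.sinh l, 0, 0; Real.sinh l, Real.cosh l, 0, 0; 0, 0, a, d; 0, 0, b, e]
  have hAT : A * T = T * R := by
    apply Matrix.ext_of_mulVec_single
    intro i
    rw [← Matrix.mulVec_mulVec, ← Matrix.mulVec_mulVec, hTy, hTy]
    fin_cases i <;>
      simp [R, hAP, hAv, hAu, hAw]
  have hRdet : R.det = a * e - b * d := by
    simp [R, Matrix.det_succ_row_zero, Fin.sum_univ_succ, Fin.succAbove]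
    linear_combination (a * e - b * d) * hcs
  -- `A` acts on the plane of `u` and `w` by an orthogonal matrix; positivity of the determinant
  -- makes it a rotation rather than a reflection.
  have hpos : 0 < a * e - b * d := by
    have h := congrArg Matrix.det hAT
    rw [Matrix.det_mul, Matrix.det_mul, mul_comm] at h
    rw [← hRdet, ← mul_left_cancel₀ hT.isUnit_det.ne_zero h]
    exact hdet
  have hone : a * e - b * d = 1 := by
    have : (a * e - b * d) ^ 2 = 1 := by
      linear_combination (d ^ 2 + e ^ 2) * n1 + n2 - (a * d + b * e) * n3
    nlinarith
  have hea : e = a := by linear_combination (-e) * n1 + a * hone + b * n3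
  have hdb : d = -b := by linear_combination (-d) * n1 + a * n3 - b * hone
  obtain ⟨θ, hc, hs⟩ := exists_cos_sin n1
  refine ⟨T, θ, hT, ?_, ?_⟩
  · rw [hTy]; simp [ofSpatial]
  · rw [hAT]
    congr 1
    simp only [R, screw, hc, hs, hea, hdb]

/-- An orientation-preserving isometry with a point of minimal positive displacement is conjugate to
a screw motion. -/
theorem exists_screw {g : HypSpace ≃ᵢ HypSpace} (hg : g ∈ isomPlus) {P : HypSpace}
    (hmin : ∀ Q, dist P (g P) ≤ dist Q (g Q)) (hP : g P ≠ P) :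
    ∃ (τ : HypSpace ≃ᵢ HypSpace) (S : Matrix (Fin 4) (Fin 4) ℝ) (θ : ℝ),
      (∀ x, (τ x).1 = S *ᵥ x.1) ∧
      ∀ x, (τ (g x)).1 = screw (dist P (g P)) θ *ᵥ (τ x).1 := by
  obtain ⟨A, hdet, hgA⟩ := hg
  have hA := isLorentz_of_isometry g.isometry hgA
  set l := dist P (g P) with hl
  have hlpos : 0 < l := dist_pos.2 hP.symm
  have hsinh := Real.sinh_pos_iff.2 hlpos
  have hcl : lorentz P.1 (g P).1 = Real.cosh l := (cosh_dist _ _).symm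
  have h12 : lorentz (g P).1 (g (g P)).1 = Real.cosh l := by
    rw [lorentz_isometry g.isometry, hcl]
  have hq := (g P).2.1
  have hqq := (g (g P)).2.1
  have hPP := P.2.1
  have hc1 : 1 < Real.cosh l := Real.one_lt_cosh.2 hlpos.ne'
  set c := Real.cosh l with hc
  -- compare the displacement of `P` with that of the midpoint of `P` and `g P`
  have hm : P.1 + (g P).1 ∈ futureCone := by
    refine ⟨add_pos P.2.2 (g P).2.2, ?_⟩
    simp only [lorentz_add_left, lorentz_add_right, hPP, hq, hcl, lorentz_comm (g P).1 P.1]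
    linarith
  have hmid := hmin (radialProj ⟨_, hm⟩)
  have hmid' : c ≤ lorentz (radialProj ⟨_, hm⟩).1 (g (radialProj ⟨_, hm⟩)).1 := by
    rw [← cosh_dist, hc, Real.cosh_le_cosh]
    exact abs_le_abs_of_nonneg dist_nonneg hmid
  set t := (√(lorentz (P.1 + (g P).1) (P.1 + (g P).1)))⁻¹ with ht
  have ht2 : t * t * (2 + 2 * c) = 1 := by
    rw [ht, ← mul_inv, Real.mul_self_sqrt hm.2.le]
    simp only [lorentz_add_left, lorentz_add_right, hPP, hq, hcl, lorentz_comm (g P).1 P.1]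
    field_simp
    ring
  -- The right side of the bound for `g² P` is the largest possible value: `2 * c ^ 2 - 1 = cosh (2
  -- * l)`. Minimality at the midpoint thus says that the path from `P` through `g P` to `g² P` does
  -- not bend.
  have hge : 2 * c ^ 2 - 1 ≤ lorentz P.1 (g (g P)).1 := by
    have e : lorentz (radialProj ⟨_, hm⟩).1 (g (radialProj ⟨_, hm⟩)).1 =
        t * t * (c + lorentz P.1 (g (g P)).1 + 1 + c) := by
      rw [hgA (radialProj ⟨_, hm⟩)]
      change lorentz (t • (P.1 + (g P).1)) (A *ᵥ (t • (P.1 + (g P).1))) = _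
      rw [Matrix.mulVec_smul, Matrix.mulVec_add, ← hgA, ← hgA]
      simp only [lorentz_add_left, lorentz_add_right, lorentz_smul_left, lorentz_smul_right, hq,
        hcl, h12]
      ring
    rw [e] at hmid'
    have hd : 0 < 2 + 2 * c := by linarith
    have := mul_le_mul_of_nonneg_left hmid' hd.le
    have e2 : (2 + 2 * c) * (t * t * (c + lorentz P.1 (g (g P)).1 + 1 + c)) =
        c + lorentz P.1 (g (g P)).1 + 1 + c := by
      linear_combination (c + lorentz P.1 (g (g P)).1 + 1 + c) * ht2
    rw [e2] at this
    nlinarith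
  -- This vector is orthogonal to `g P`, and `hge` makes its norm nonnegative, so it vanishes. The
  -- recurrence shows that the plane of `P` and `g P` is invariant.
  have hrec : (g (g P)).1 - (2 * c) • (g P).1 + P.1 = 0 := by
    apply eq_zero_of_lorentz_nonneg (g P)
    · simp only [lorentz_add_left, lorentz_sub_left, lorentz_smul_left, hq, hcl,
        lorentz_comm (g (g P)).1 (g P).1, h12]
      ring
    · simp only [lorentz_add_left, lorentz_sub_left, lorentz_smul_left, lorentz_add_right,
        lorentz_sub_right, lorentz_smul_right, hq, hqq, hPP, hcl,
        lorentz_comm (g (g P)).1 (g P).1, h12, lorentz_comm (g (g P)).1 P.1,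
        lorentz_comm (g P).1 P.1]
      nlinarith
  set s := Real.sinh l with hs
  have hcs : c ^ 2 = s ^ 2 + 1 := Real.cosh_sq l
  -- The unit tangent vector at `P` pointing to `g P`.
  set v : Fin 4 → ℝ := s⁻¹ • ((g P).1 - c • P.1) with hv
  have hgv : (g P).1 = c • P.1 + s • v := by
    rw [hv, smul_smul, mul_inv_cancel₀ hsinh.ne']; module
  obtain ⟨T, θ, hT, hT0, hAT⟩ := exists_conj_screw hA hdet P (v := v) (l := l) (by
      rw [hv]
      simp only [lorentz_sub_left, lorentz_smul_left, lorentz_sub_right, lorentz_smul_right, hq,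
        hPP, hcl, lorentz_comm (g P).1 P.1]
      field_simp
      linarith) (by
      rw [hv]
      simp only [lorentz_sub_left, lorentz_smul_left, hPP, lorentz_comm (g P).1 P.1, hcl]
      ring) (by rw [← hgA, hgv]) (by
      have : (g (g P)).1 = (2 * c) • (g P).1 - P.1 := by
        rw [← sub_eq_zero, ← hrec]; module
      rw [hv, Matrix.mulVec_smul, Matrix.mulVec_sub, Matrix.mulVec_smul, ← hgA, ← hgA, this]
      have e : (2 * c) • (g P).1 - P.1 - c • (g P).1 =
          (s ^ 2) • P.1 + (s * c) • v := by
        rw [mul_comm s c, mul_smul c s v]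
        have : s • v = (g P).1 - c • P.1 := by rw [hgv]; module
        rw [this]
        have e3 : s ^ 2 = c ^ 2 - 1 := by linarith
        rw [e3]; module
      rw [e, smul_add, smul_smul, smul_smul, sq, ← mul_assoc, ← mul_assoc,
        inv_mul_cancel₀ hsinh.ne', one_mul, one_mul])
  obtain ⟨σ, hσ, hσ'⟩ := hT.exists_isometryEquiv hT0
  refine ⟨σ.symm, T⁻¹, θ, hσ', fun x => ?_⟩
  rw [hσ', hσ', hgA, Matrix.mulVec_mulVec, Matrix.mulVec_mulVec]
  congr 1
  have hu := hT.isUnit_det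
  calc T⁻¹ * A = T⁻¹ * (A * T) * T⁻¹ := by
        rw [Matrix.mul_assoc, Matrix.mul_assoc, Matrix.mul_nonsing_inv _ hu, Matrix.mul_one]
    _ = _ := by
        rw [hAT, ← Matrix.mul_assoc, Matrix.nonsing_inv_mul _ hu, Matrix.one_mul]

end HypSpace

namespace HypSpace

/-! ### Discrete cocompact groups -/

section Discrete

variable {Γ : Subgroup (HypSpace ≃ᵢ HypSpace)}

/-- The compact-open topology is that of uniform convergence on compact sets, and the identity is
isolated in a discrete group. -/
theorem exists_isCompact_forall_dist_lt (hd : DiscreteTopology Γ) :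
    ∃ (K : Set HypSpace) (ε : ℝ), IsCompact K ∧ 0 < ε ∧
      ∀ g : Γ, (∀ x ∈ K, dist x (g.1 x) < ε) → g = 1 := by
  obtain ⟨V, hV, hV1⟩ := isOpen_induced_iff.1 (isOpen_discrete ({1} : Set Γ))
  obtain ⟨W, hW, rfl⟩ := isOpen_induced_iff.1 hV
  have h1 : (⟨(1 : HypSpace ≃ᵢ HypSpace), (1 : HypSpace ≃ᵢ HypSpace).continuous⟩ :
      C(HypSpace, HypSpace)) ∈ W := by
    have : (1 : Γ) ∈ ({1} : Set Γ) := rfl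
    rw [← hV1] at this
    exact this
  obtain ⟨V', hV', hVW⟩ := UniformSpace.mem_nhds_iff.1 (hW.mem_nhds h1)
  obtain ⟨K, U, hK, hU, hKU⟩ := (ContinuousMap.mem_compactConvergence_entourage_iff _).1 hV'
  obtain ⟨ε, hε, hεU⟩ := Metric.mem_uniformity_dist.1 hU
  refine ⟨K, ε, hK, hε, fun g hg => ?_⟩
  have : g ∈ ({1} : Set Γ) := by
    rw [← hV1]
    exact hVW (hKU fun x hx => hεU (hg x hx))
  exact this

/-- A discrete group of isometries acts properly discontinuously. -/
theorem finite_setOf_dist_le (hd : DiscreteTopology Γ) (P : HypSpace) (R : ℝ) :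
    {g : Γ | dist P (g.1 P) ≤ R}.Finite := by
  obtain ⟨K, ε, hK, hε, h1⟩ := exists_isCompact_forall_dist_lt hd
  obtain ⟨N, hN, hKN⟩ := Metric.totallyBounded_iff.1 hK.totallyBounded (ε / 4) (by positivity)
  have : Fintype N := hN.fintype
  -- An Arzelà–Ascoli pigeonhole: among infinitely many elements two have the same approximate
  -- values, up to `ε / 4`, on an `ε / 4`-net of `K`, so they differ by less than `ε` on `K`.
  by_contra hinf
  have hB : IsCompact (Set.univ.pi fun x : N => Metric.closedBall P (R + dist P x)) :=
    isCompact_univ_pi fun x => isCompact_closedBall _ _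
  obtain ⟨M, hM, hBM⟩ := Metric.totallyBounded_iff.1 hB.totallyBounded (ε / 4) (by positivity)
  have hmem : ∀ g ∈ {g : Γ | dist P (g.1 P) ≤ R}, ∃ y ∈ M,
      dist (fun x : N => g.1 x.1) y < ε / 4 := by
    intro g hg
    have : (fun x : N => g.1 x.1) ∈
        Set.univ.pi fun x : N => Metric.closedBall P (R + dist P x) := by
      intro x _
      rw [Metric.mem_closedBall, dist_comm]
      refine (dist_triangle _ (g.1 P) _).trans (add_le_add hg ?_)
      rw [g.1.isometry.dist_eq]
    simpa using hBM this
  have : Nonempty HypSpace := ⟨P⟩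
  choose! c hcM hc using hmem
  obtain ⟨g, hg, g', hg', hne, heq⟩ := Set.Infinite.exists_ne_map_eq_of_mapsTo hinf hcM hM
  refine hne (inv_mul_eq_one.1 (h1 (g⁻¹ * g') fun x hx => ?_))
  have hxN := hKN hx
  simp only [Set.mem_iUnion, Metric.mem_ball] at hxN
  obtain ⟨y, hy, hxy⟩ := hxN
  have e : dist x ((g⁻¹ * g').1 x) = dist (g.1 x) (g'.1 x) := by
    rw [← g.1.isometry.dist_eq]
    congr 1
    exact IsometryEquiv.apply_inv_self g.1 (g'.1 x)
  rw [e]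
  have e1 : dist (g.1 x) (g.1 y) < ε / 4 := by rwa [g.1.isometry.dist_eq]
  have e2 : dist (g'.1 y) (g'.1 x) < ε / 4 := by rwa [g'.1.isometry.dist_eq, dist_comm]
  have e3 := (dist_le_pi_dist (fun x : N => g.1 x.1) (c g) ⟨y, hy⟩).trans_lt (hc g hg)
  have e4 := (dist_le_pi_dist (fun x : N => g'.1 x.1) (c g') ⟨y, hy⟩).trans_lt (hc g' hg')
  simp only at e3 e4
  rw [← heq, dist_comm] at e4
  linarith [dist_triangle4 (g.1 x) (g.1 y) (g'.1 y) (g'.1 x),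
    dist_triangle (g.1 y) (c g ⟨y, hy⟩) (g'.1 y)]

/-- A fixed point would be fixed by all powers, which are infinitely many, against proper
discontinuity. -/
theorem apply_ne_self (hd : DiscreteTopology Γ) (htf : ∀ g : Γ, g ≠ 1 → ¬ IsOfFinOrder g)
    {g : Γ} (hg : g ≠ 1) (P : HypSpace) : g.1 P ≠ P := by
  intro h
  have hpow : ∀ n : ℕ, (g ^ n).1 P = P := fun n => by
    induction n with
    | zero => rfl
    | succ n ih =>
      rw [pow_succ]
      change (g ^ n).1 (g.1 P) = P
      rw [h, ih]
  have hinf := Set.infinite_range_of_injective (injective_pow_iff_not_isOfFinOrder.2 (htf g hg))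
  refine hinf ((finite_setOf_dist_le hd P 0).subset ?_)
  rintro _ ⟨n, rfl⟩
  change dist P ((g ^ n).1 P) ≤ 0
  rw [hpow, dist_self]

theorem exists_forall_exists_dist_le
    (hc : CompactSpace (MulAction.orbitRel.Quotient Γ HypSpace)) (o : HypSpace) :
    ∃ R : ℝ, ∀ Q, ∃ g : Γ, dist o (g.1 Q) ≤ R := by
  have : ContinuousConstSMul Γ HypSpace := ⟨fun g => g.1.continuous⟩
  have ho : IsOpenMap (Quotient.mk (MulAction.orbitRel Γ HypSpace)) := isOpenMap_quotient_mk'_mul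
  have hdir : Directed (· ⊆ ·) fun n : ℕ =>
      Quotient.mk (MulAction.orbitRel Γ HypSpace) '' Metric.ball o n :=
    directed_of_isDirected_le fun m n hmn =>
      Set.image_mono (Metric.ball_subset_ball (Nat.cast_le.2 hmn))
  obtain ⟨n, hn⟩ := (isCompact_univ
    (X := MulAction.orbitRel.Quotient Γ HypSpace)).elim_directed_cover
    (fun n : ℕ => Quotient.mk (MulAction.orbitRel Γ HypSpace) '' Metric.ball o n)
    (fun n => ho _ Metric.isOpen_ball) (by
      intro q _
      obtain ⟨Q, rfl⟩ := Quotient.exists_rep q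
      obtain ⟨n, hn⟩ := exists_nat_gt (dist Q o)
      exact Set.mem_iUnion.2 ⟨n, Q, hn, rfl⟩) hdir
  refine ⟨n, fun Q => ?_⟩
  obtain ⟨Q', hQ', h⟩ := hn (Set.mem_univ (Quotient.mk (MulAction.orbitRel Γ HypSpace) Q))
  obtain ⟨g, hg⟩ := MulAction.orbitRel_apply.1 (Quotient.exact h)
  refine ⟨g, ?_⟩
  change g.1 Q = Q' at hg
  rw [hg, dist_comm]
  exact (Metric.mem_ball.1 hQ').le

/-- In a discrete cocompact group every element has a point of minimal displacement. -/
theorem exists_forall_dist_le (hd : DiscreteTopology Γ)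
    (hc : CompactSpace (MulAction.orbitRel.Quotient Γ HypSpace)) (g : Γ) :
    ∃ P, ∀ Q, dist P (g.1 P) ≤ dist Q (g.1 Q) := by
  set o := ofSpatial 0
  obtain ⟨R, hR⟩ := exists_forall_exists_dist_le hc o
  have hR0 : 0 ≤ R := by
    obtain ⟨h, hh⟩ := hR o
    exact dist_nonneg.trans hh
  have hmin : ∀ h : Γ, ∃ x ∈ Metric.closedBall o R, ∀ y ∈ Metric.closedBall o R,
      dist x (h.1 x) ≤ dist y (h.1 y) := fun h =>
    (isCompact_closedBall o R).exists_isMinOn ⟨o, Metric.mem_closedBall_self hR0⟩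
      (continuous_id.dist h.1.continuous).continuousOn
  choose m hmB hm using hmin
  set d := dist o (g.1 o)
  -- Moving a point `Q` into the ball of radius `R` replaces `g` by a conjugate. If the displacement
  -- of `Q` is at most `d`, that conjugate belongs to the finite set `Ψ`, so the infimum is a
  -- minimum over finitely many conjugates, each attained on a compact ball.
  let Ψ : Set Γ := {h | dist o (h.1 o) ≤ d + 2 * R} ∩ {h | ∃ k : Γ, h = k * g * k⁻¹}
  have hΨ : Ψ.Finite := (finite_setOf_dist_le hd o _).inter_of_left _
  have key : ∀ Q, dist Q (g.1 Q) ≤ d → ∃ h ∈ Ψ, dist (m h) (h.1 (m h)) ≤ dist Q (g.1 Q) := by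
    intro Q hQ
    obtain ⟨k, hk⟩ := hR Q
    have e : (k * g * k⁻¹).1 (k.1 Q) = k.1 (g.1 Q) := by
      change k.1 (g.1 (k.1⁻¹ (k.1 Q))) = _
      rw [IsometryEquiv.inv_apply_self]
    have e2 : dist (k.1 Q) ((k * g * k⁻¹).1 (k.1 Q)) = dist Q (g.1 Q) := by
      rw [e, k.1.isometry.dist_eq]
    refine ⟨k * g * k⁻¹, ⟨?_, k, rfl⟩, ?_⟩
    · have t1 := dist_triangle4 o (k.1 Q) ((k * g * k⁻¹).1 (k.1 Q)) ((k * g * k⁻¹).1 o)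
      rw [e2, (k * g * k⁻¹).1.isometry.dist_eq, dist_comm (k.1 Q) o] at t1
      change dist o ((k * g * k⁻¹).1 o) ≤ d + 2 * R
      linarith
    · rw [← e2]
      exact hm _ _ (by rwa [Metric.mem_closedBall, dist_comm])
  obtain ⟨h₀, hh₀, h₀d⟩ := key o le_rfl
  obtain ⟨h, ⟨-, k, rfl⟩, hmin⟩ := Set.exists_min_image Ψ (fun h => dist (m h) (h.1 (m h))) hΨ
    ⟨h₀, hh₀⟩
  set x := m (k * g * k⁻¹)
  have ex : dist (k⁻¹.1 x) (g.1 (k⁻¹.1 x)) = dist x ((k * g * k⁻¹).1 x) := by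
    rw [← k.1.isometry.dist_eq]
    congr 1
    exact IsometryEquiv.apply_inv_self k.1 x
  refine ⟨k⁻¹.1 x, fun Q => ?_⟩
  rw [ex]
  rcases le_total (dist Q (g.1 Q)) d with hQ | hQ
  · obtain ⟨h', hh', h''⟩ := key Q hQ
    exact (hmin h' hh').trans h''
  · exact ((hmin h₀ hh₀).trans h₀d).trans hQ

end Discrete

/-! ### Screw motions and tubes -/

/-- Coordinates in which an isometry is a screw motion of positive translation length. -/
structure ScrewData (g : HypSpace ≃ᵢ HypSpace) where
  /-- The coordinate change. -/
  τ : HypSpace ≃ᵢ HypSpace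
  /-- The matrix of the coordinate change. -/
  S : Matrix (Fin 4) (Fin 4) ℝ
  /-- The translation length. -/
  l : ℝ
  /-- The rotation angle. -/
  θ : ℝ
  l_pos : 0 < l
  τ_eq : ∀ x, (τ x).1 = S *ᵥ x.1
  conj : ∀ x, (τ (g x)).1 = screw l θ *ᵥ (τ x).1

theorem nonempty_screwData {Γ : Subgroup (HypSpace ≃ᵢ HypSpace)} (horient : Γ ≤ isomPlus)
    (hd : DiscreteTopology Γ) (htf : ∀ g : Γ, g ≠ 1 → ¬ IsOfFinOrder g)
    (hc : CompactSpace (MulAction.orbitRel.Quotient Γ HypSpace)) {g : Γ} (hg : g ≠ 1) :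
    Nonempty (ScrewData g.1) := by
  obtain ⟨P, hP⟩ := exists_forall_dist_le hd hc g
  have hne := apply_ne_self hd htf hg P
  obtain ⟨τ, S, θ, h1, h2⟩ := exists_screw (horient g.2) hP hne
  exact ⟨⟨τ, S, _, θ, dist_pos.2 hne.symm, h1, h2⟩⟩

/-- The unit speed parametrization of the line `x₂ = x₃ = 0`. -/
noncomputable def linePoint (t : ℝ) : HypSpace :=
  ⟨![Real.cosh t, Real.sinh t, 0, 0], by
    have := Real.cosh_sq t
    simp [lorentz_eq]; linarith, Real.cosh_pos t⟩

theorem isometry_linePoint : Isometry linePoint := by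
  refine Isometry.of_dist_eq fun s t => ?_
  have : lorentz (linePoint s).1 (linePoint t).1 = Real.cosh |s - t| := by
    rw [Real.cosh_abs, Real.cosh_sub]
    simp [lorentz_eq, linePoint]
  change Real.arcosh _ = _
  rw [this, Real.arcosh_cosh (abs_nonneg _), Real.dist_eq]

theorem axisSq_linePoint (t : ℝ) : axisSq (linePoint t).1 = 0 := by
  simp [axisSq, linePoint]

theorem axisSq_nonneg (y : Fin 4 → ℝ) : 0 ≤ axisSq y := by
  unfold axisSq; positivity

/-- As `axisSq` is the squared `sinh` of the distance to the axis, the radius is `arsinh √κ`. -/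
theorem isCylinder_tube (τ : HypSpace ≃ᵢ HypSpace) {κ : ℝ} (hκ : 0 < κ) :
    IsCylinder {x | axisSq (τ x).1 < κ} := by
  refine ⟨_, ⟨fun t => τ.symm (linePoint t), τ.symm.isometry.comp isometry_linePoint, rfl⟩,
    Real.arsinh √κ, Real.arsinh_pos_iff.2 (Real.sqrt_pos.2 hκ), ?_⟩
  set r := Real.arsinh √κ with hr
  have hr0 : 0 < r := Real.arsinh_pos_iff.2 (Real.sqrt_pos.2 hκ)
  have hcr : Real.cosh r ^ 2 = 1 + κ := by
    rw [Real.cosh_sq, hr, Real.sinh_arsinh, Real.sq_sqrt hκ.le, add_comm]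
  ext x
  rw [Metric.mem_thickening_iff, Set.exists_range_iff]
  have hd : ∀ t, dist x (τ.symm (linePoint t)) < r ↔
      (τ x).1 0 * Real.cosh t - (τ x).1 1 * Real.sinh t < Real.cosh r := fun t => by
    rw [← τ.isometry.dist_eq, τ.apply_symm_apply, dist_lt_iff hr0.le]
    simp [lorentz_eq, linePoint]
  simp only [hd, Set.mem_ofPred_eq]
  set y := τ x with hy
  have hyy := y.2.1
  rw [lorentz_eq] at hyy
  have hax : y.1 0 ^ 2 - y.1 1 ^ 2 = 1 + axisSq y.1 := by
    unfold axisSq; linarith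
  constructor
  · intro h
    have hw0 : 0 < 1 + axisSq y.1 := by linarith [axisSq_nonneg y.1]
    -- Dividing the first two coordinates by `w` gives a point of the unit hyperbola: the foot of
    -- the perpendicular to the axis.
    set w := √(1 + axisSq y.1) with hw
    have hw2 : w ^ 2 = 1 + axisSq y.1 := Real.sq_sqrt hw0.le
    have hwpos : 0 < w := Real.sqrt_pos.2 hw0
    have hs : Real.sinh (Real.arsinh (y.1 1 / w)) = y.1 1 / w := Real.sinh_arsinh _
    have hc : Real.cosh (Real.arsinh (y.1 1 / w)) = y.1 0 / w := by
      rw [← sq_eq_sq₀ (Real.cosh_pos _).le (div_nonneg y.2.2.le hwpos.le), Real.cosh_sq, hs]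
      field_simp
      linarith
    refine ⟨Real.arsinh (y.1 1 / w), ?_⟩
    rw [hs, hc]
    have e : y.1 0 * (y.1 0 / w) - y.1 1 * (y.1 1 / w) = w := by
      field_simp
      linarith
    rw [e]
    exact lt_of_pow_lt_pow_left₀ 2 (Real.cosh_pos _).le (by rw [hw2, hcr]; linarith)
  · rintro ⟨t, ht⟩
    have h1 : 1 ≤ y.1 0 * Real.cosh t - y.1 1 * Real.sinh t := by
      have := one_le_lorentz y (linePoint t)
      simpa [lorentz_eq, linePoint] using this
    have h2 := pow_lt_pow_left₀ ht (by linarith) two_ne_zero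
    have h3 := Real.cosh_sq t
    rw [hcr] at h2
    nlinarith [sq_nonneg (y.1 0 * Real.sinh t - y.1 1 * Real.cosh t)]

namespace ScrewData

variable {g : HypSpace ≃ᵢ HypSpace} (D : ScrewData g)

theorem conj_pow (n : ℕ) (x : HypSpace) :
    (D.τ ((g ^ n) x)).1 = screw (n * D.l) (n * D.θ) *ᵥ (D.τ x).1 := by
  induction n with
  | zero => simp [screw_zero]
  | succ n ih =>
    rw [pow_succ', IsometryEquiv.mul_apply, D.conj, ih, Matrix.mulVec_mulVec, screw_mul]
    congr 2 <;> push_cast <;> ring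

theorem conj_zpow (n : ℤ) (x : HypSpace) :
    (D.τ ((g ^ n) x)).1 = screw (n * D.l) (n * D.θ) *ᵥ (D.τ x).1 := by
  obtain ⟨k, rfl | rfl⟩ := n.eq_nat_or_neg
  · rw [zpow_natCast]; exact_mod_cast D.conj_pow k x
  · have h := D.conj_pow k ((g ^ (-(k : ℤ))) x)
    rw [zpow_neg, zpow_natCast, IsometryEquiv.apply_inv_self] at h
    rw [h, Matrix.mulVec_mulVec, screw_mul, zpow_neg, zpow_natCast]
    push_cast
    rw [neg_mul, neg_mul, neg_add_cancel, neg_add_cancel, screw_zero, Matrix.one_mulVec]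

theorem cosh_dist_zpow (n : ℤ) (x : HypSpace) :
    Real.cosh (dist x ((g ^ n) x)) = Real.cosh (n * D.l) +
      axisSq (D.τ x).1 * (Real.cosh (n * D.l) - Real.cos (n * D.θ)) := by
  rw [← D.τ.isometry.dist_eq, cosh_dist, D.conj_zpow, lorentz_screw]

theorem cosh_le {n : ℤ} (hn : n ≠ 0) : Real.cosh D.l ≤ Real.cosh (n * D.l) := by
  rw [Real.cosh_le_cosh, abs_mul]
  refine le_mul_of_one_le_left (abs_nonneg _) ?_
  exact_mod_cast Int.one_le_abs hn

theorem one_lt_cosh : 1 < Real.cosh D.l := Real.one_lt_cosh.2 D.l_pos.ne'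

theorem coeff_pos {n : ℤ} (hn : n ≠ 0) :
    0 < Real.cosh (n * D.l) - Real.cos (n * D.θ) := by
  linarith [D.cosh_le hn, D.one_lt_cosh, Real.cos_le_one (n * D.θ)]

theorem zpow_ne_one (D : ScrewData g) {n : ℤ} (hn : n ≠ 0) : g ^ n ≠ 1 := by
  intro h
  have := D.cosh_dist_zpow n (D.τ.symm (linePoint 0))
  rw [h, D.τ.apply_symm_apply, axisSq_linePoint, IsometryEquiv.coe_one, id, dist_self,
    Real.cosh_zero] at this
  linarith [D.cosh_le hn, D.one_lt_cosh]

theorem dist_axis : dist (D.τ.symm (linePoint 0)) (g (D.τ.symm (linePoint 0))) = D.l := by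
  have := D.cosh_dist_zpow 1 (D.τ.symm (linePoint 0))
  rw [D.τ.apply_symm_apply, axisSq_linePoint, zpow_one, Int.cast_one, one_mul, zero_mul,
    add_zero] at this
  exact Real.cosh_injOn dist_nonneg D.l_pos.le this

theorem l_le_dist {n : ℤ} (hn : n ≠ 0) (x : HypSpace) : D.l ≤ dist x ((g ^ n) x) := by
  rw [← abs_of_pos D.l_pos, ← abs_of_nonneg (dist_nonneg (x := x) (y := (g ^ n) x)),
    ← Real.cosh_le_cosh, D.cosh_dist_zpow]
  have := mul_nonneg (axisSq_nonneg (D.τ x).1) (D.coeff_pos hn).le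
  linarith [D.cosh_le hn]

theorem translationLength_le : translationLength g ≤ D.l := by
  rw [← D.dist_axis]
  exact ciInf_le ⟨0, by rintro _ ⟨P, rfl⟩; exact dist_nonneg⟩ (D.τ.symm (linePoint 0))

/-- A point of minimal displacement of a power of `g` lies on the axis of `g`. -/
theorem dist_le_of_isMin (D : ScrewData g) {n : ℤ} (hn : n ≠ 0) {P : HypSpace}
    (hP : ∀ Q, dist P ((g ^ n) P) ≤ dist Q ((g ^ n) Q)) :
    dist P (g P) ≤ dist P ((g ^ n) P) := by
  have h := hP (D.τ.symm (linePoint 0))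
  rw [← abs_of_nonneg (dist_nonneg (x := P)), ← abs_of_nonneg (dist_nonneg
    (x := D.τ.symm (linePoint 0))), ← Real.cosh_le_cosh, D.cosh_dist_zpow, D.cosh_dist_zpow,
    D.τ.apply_symm_apply, axisSq_linePoint, zero_mul, add_zero] at h
  -- Off the axis the displacement by `g ^ n` is strictly larger than on it.
  have h0 : axisSq (D.τ P).1 = 0 := by
    refine le_antisymm ?_ (axisSq_nonneg _)
    by_contra! hpos
    linarith [mul_pos hpos (D.coeff_pos hn)]
  have h1 := D.cosh_dist_zpow 1 P
  rw [h0, zpow_one, Int.cast_one, one_mul, zero_mul, add_zero] at h1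
  rw [Real.cosh_injOn dist_nonneg D.l_pos.le h1]
  exact D.l_le_dist hn P

/-- The points displaced by less than `lam` by a nontrivial power of `g` form a tube. -/
theorem exists_tube {lam : ℝ} (hlam : 0 < lam)
    (hne : {x | ∃ n : ℤ, n ≠ 0 ∧ dist x ((g ^ n) x) < lam}.Nonempty) :
    ∃ κ : ℝ, 0 < κ ∧
      {x | ∃ n : ℤ, n ≠ 0 ∧ dist x ((g ^ n) x) < lam} = {x | axisSq (D.τ x).1 < κ} := by
  -- Solving the displacement formula for `axisSq` gives one threshold for each power. The union of
  -- the resulting tubes has the supremum as its threshold; the thresholds are bounded since the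
  -- denominators are at least `cosh l - 1`.
  let κ : {n : ℤ // n ≠ 0} → ℝ := fun n =>
    (Real.cosh lam - Real.cosh (n * D.l)) / (Real.cosh (n * D.l) - Real.cos (n * D.θ))
  have hiff : ∀ (n : {n : ℤ // n ≠ 0}) x,
      dist x ((g ^ n.1) x) < lam ↔ axisSq (D.τ x).1 < κ n := fun n x => by
    rw [lt_div_iff₀ (D.coeff_pos n.2), lt_sub_iff_add_lt', ← D.cosh_dist_zpow, Real.cosh_lt_cosh,
      abs_of_nonneg dist_nonneg, abs_of_pos hlam]
  have hbdd : BddAbove (Set.range κ) := by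
    refine ⟨Real.cosh lam / (Real.cosh D.l - 1), ?_⟩
    rintro _ ⟨n, rfl⟩
    refine div_le_div₀ (Real.cosh_pos _).le ?_ (by linarith [D.one_lt_cosh]) ?_
    · linarith [Real.cosh_pos (n.1 * D.l)]
    · linarith [D.cosh_le n.2, Real.cos_le_one (n.1 * D.θ)]
  have : Nonempty {n : ℤ // n ≠ 0} := ⟨⟨1, one_ne_zero⟩⟩
  have hset : ∀ x, (∃ n : ℤ, n ≠ 0 ∧ dist x ((g ^ n) x) < lam) ↔
      axisSq (D.τ x).1 < ⨆ n, κ n := fun x => by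
    rw [lt_ciSup_iff hbdd, Subtype.exists]
    simp only [← hiff, exists_prop]
  refine ⟨⨆ n, κ n, ?_, Set.ext hset⟩
  obtain ⟨x, hx⟩ := hne
  exact (axisSq_nonneg _).trans_lt ((hset x).1 hx)

end ScrewData

end HypSpace

/-! ### Nerves, links and complements of subcomplexes -/

namespace PreAbstractSimplicialComplex

variable {ι : Type*}

theorem isUpperFaces_faces (K : PreAbstractSimplicialComplex ι) : K.IsUpperFaces K.faces :=
  ⟨subset_rfl, fun _ _ _ ht _ => ht⟩

theorem isUpperFaces_diff (K L : PreAbstractSimplicialComplex ι) :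
    K.IsUpperFaces (K.faces \ L.faces) :=
  ⟨Set.sdiff_subset, fun _ hs _ ht hst =>
    ⟨ht, fun h => hs.2 ((L.isRelLowerSet_faces h).2 hst (K.isRelLowerSet_faces hs.1).1)⟩⟩

theorem compl_realizationOf (K L : PreAbstractSimplicialComplex ι) :
    (K.realizationOf L)ᶜ = K.openPart (K.faces \ L.faces) := by
  ext x
  exact ⟨fun h => ⟨x.2.2.2, h⟩, fun h => h.2⟩

variable {E : Type*} [NormedAddCommGroup E] [NormedSpace ℝ E] {U : ι → Set E}

theorem contractibleSpace_nerve (hopen : ∀ i, IsOpen (U i))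
    (hconv : ∀ i, Convex ℝ (U i)) (hX : Convex ℝ (⋃ i, U i)) (hne : (⋃ i, U i).Nonempty)
    (hfin : ∀ x ∈ ⋃ i, U i, ∃ t ∈ 𝓝 x, {i | (U i ∩ t).Nonempty}.Finite) :
    ContractibleSpace (nerve U).Realization := by
  have h := contractibleSpace_openPart_nerve hopen hconv hX hne hfin (isUpperFaces_faces _)
    fun x hx s hs => by
      obtain ⟨i, hi⟩ := Set.mem_iUnion.1 hx
      exact ⟨⟨i, (hs i).2 hi⟩, x, Set.mem_iInter₂.2 fun j hj => (hs j).1 hj⟩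
  have e : (nerve U).openPart (nerve U).faces = Set.univ :=
    Set.eq_univ_of_forall fun x => x.2.2.2
  rw [e] at h
  exact (Homeomorph.Set.univ _).symm.contractibleSpace

open Classical in
-- A common point for `τ` and all of `σ` is a common point of the intersected sets. Vertices of `σ`
-- are given the empty set, which removes them from the nerve while keeping the index type.
theorem link_nerve {X : Type*} (U : ι → Set X) (σ : Finset ι) :
    (nerve U).link σ = nerve fun i => if i ∈ σ then ∅ else U i ∩ ⋂ j ∈ σ, U j := by
  ext τ
  constructor
  · rintro ⟨hτ, hd, φ, ⟨-, x, hx⟩, hτφ, hσφ⟩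
    refine ⟨hτ.1, x, Set.mem_iInter₂.2 fun i hi => ?_⟩
    rw [Set.mem_iInter₂] at hx
    beta_reduce
    rw [if_neg (Finset.disjoint_left.1 hd hi)]
    exact ⟨hx i (hτφ hi), Set.mem_iInter₂.2 fun j hj => hx j (hσφ hj)⟩
  · rintro ⟨⟨i₀, hi₀⟩, x, hx⟩
    rw [Set.mem_iInter₂] at hx
    beta_reduce at hx
    have hd : ∀ i ∈ τ, i ∉ σ := fun i hi h => by
      have := hx i hi
      rw [if_pos h] at this
      exact this
    have hx' : ∀ i ∈ τ, x ∈ U i ∩ ⋂ j ∈ σ, U j := fun i hi => by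
      have := hx i hi
      rwa [if_neg (hd i hi)] at this
    refine ⟨⟨⟨i₀, hi₀⟩, x, Set.mem_iInter₂.2 fun i hi => (hx' i hi).1⟩,
      Finset.disjoint_left.2 fun i hi => hd i hi, τ ∪ σ,
      ⟨⟨i₀, Finset.mem_union_left _ hi₀⟩, x, Set.mem_iInter₂.2 fun i hi => ?_⟩,
      Finset.subset_union_left, Finset.subset_union_right⟩
    rcases Finset.mem_union.1 hi with h | h
    · exact (hx' i h).1
    · exact Set.mem_iInter₂.1 (hx' i₀ hi₀).2 i h

theorem contractibleSpace_link_nerve (hopen : ∀ i, IsOpen (U i))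
    (hconv : ∀ i, Convex ℝ (U i))
    (hfin : ∀ x ∈ ⋃ i, U i, ∃ t ∈ 𝓝 x, {i | (U i ∩ t).Nonempty}.Finite)
    {σ : Finset ι} (hσ : σ ∈ (nerve U).faces)
    (hcover : ∀ x ∈ ⋂ j ∈ σ, U j, ∃ i ∉ σ, x ∈ U i) :
    ContractibleSpace ((nerve U).link σ).Realization := by
  classical
  rw [link_nerve]
  set V : ι → Set E := fun i => if i ∈ σ then ∅ else U i ∩ ⋂ j ∈ σ, U j with hV
  have hsub : ∀ i, V i ⊆ U i := fun i => by
    simp only [hV]; split_ifs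
    exacts [Set.empty_subset _, Set.inter_subset_left]
  have hunion : ⋃ i, V i = ⋂ j ∈ σ, U j := by
    refine subset_antisymm (Set.iUnion_subset fun i => ?_) fun x hx => ?_
    · simp only [hV]; split_ifs
      exacts [Set.empty_subset _, Set.inter_subset_right]
    · obtain ⟨i, hi, hxi⟩ := hcover x hx
      refine Set.mem_iUnion.2 ⟨i, ?_⟩
      simp only [hV, if_neg hi]
      exact ⟨hxi, hx⟩
  have hconvσ : Convex ℝ (⋂ j ∈ σ, U j) := convex_iInter₂ fun j _ => hconv j
  refine contractibleSpace_nerve (fun i => ?_) (fun i => ?_) ?_ ?_ fun x hx => ?_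
  · simp only [hV]; split_ifs
    exacts [isOpen_empty, (hopen i).inter (isOpen_biInter_finset fun j _ => hopen j)]
  · simp only [hV]; split_ifs
    exacts [convex_empty, (hconv i).inter hconvσ]
  · rw [hunion]; exact hconvσ
  · rw [hunion]; exact hσ.2
  · obtain ⟨t, ht, hfin⟩ := hfin x (Set.iUnion_mono hsub hx)
    exact ⟨t, ht, hfin.subset fun i hi => hi.mono (Set.inter_subset_inter_left _ (hsub i))⟩

/-- Common points correspond under radial projection and the inclusion of the hyperboloid. -/
theorem nerve_coneOver (A : ι → Set HypSpace) :
    (nerve fun i => HypSpace.coneOver (A i)) = nerve A := by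
  ext s
  constructor
  · rintro ⟨⟨i, hi⟩, x, hx⟩
    rw [Set.mem_iInter₂] at hx
    exact ⟨⟨i, hi⟩, HypSpace.radialProj ⟨x, (hx i hi).1⟩,
      Set.mem_iInter₂.2 fun j hj => (hx j hj).2⟩
  · rintro ⟨hs, x, hx⟩
    rw [Set.mem_iInter₂] at hx
    exact ⟨hs, x.1, Set.mem_iInter₂.2 fun j hj => HypSpace.coe_mem_coneOver.2 (hx j hj)⟩

end PreAbstractSimplicialComplex

theorem internalRank_empty {G : Type*} [Group G] : internalRank (∅ : Set (Subgroup G)) = 0 := by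
  rw [internalRank, Set.powerset_empty, iSup_singleton, sSup_empty, ← nonpos_iff_eq_zero]
  refine (iInf₂_le (∅ : Finset (⊥ : Subgroup G)) ?_).trans_eq (by simp)
  exact Subsingleton.elim _ _

/-! ### The family of cylinders of a group -/

namespace HypSpace

variable {Γ : Subgroup (HypSpace ≃ᵢ HypSpace)} {lam : ℝ}

theorem cylinder_zpowers {g : Γ} (D : ScrewData g.1) :
    cylinder Γ lam (Subgroup.zpowers g) =
      {x | ∃ n : ℤ, n ≠ 0 ∧ dist x ((g.1 ^ n) x) < lam} := by
  ext x
  constructor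
  · rintro ⟨h, ⟨n, rfl⟩, hne, hlt⟩
    refine ⟨n, ?_, hlt⟩
    rintro rfl
    exact hne (zpow_zero g)
  · rintro ⟨n, hn, hlt⟩
    refine ⟨g ^ n, ⟨n, rfl⟩, fun h => D.zpow_ne_one hn ?_, hlt⟩
    rw [← Subgroup.coe_zpow, h, Subgroup.coe_one]

/-- If some nontrivial power moves `P` by less than `lam`, the generator has still smaller
translation length, since no nontrivial power moves a point by less than `l`. -/
theorem shortAt_subset_shortCyclic (hD : ∀ g : Γ, g ≠ 1 → Nonempty (ScrewData g.1))
    (P : HypSpace) : shortAt Γ lam P ⊆ shortCyclic Γ lam := by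
  rintro C ⟨hC, h, hhC, hne, hlt⟩
  obtain ⟨g, rfl⟩ := (Subgroup.isCyclic_iff_exists_zpowers_eq_top _).1 hC.prop
  obtain ⟨n, rfl⟩ := hhC
  have hg : g ≠ 1 := fun h => hne (by simp [h])
  have hn : n ≠ 0 := by rintro rfl; exact hne (zpow_zero g)
  obtain ⟨D⟩ := hD g hg
  exact ⟨hC, g, rfl, D.translationLength_le.trans_lt ((D.l_le_dist hn P).trans_lt hlt)⟩

/-- In a nontrivial group the trivial subgroup is not maximal cyclic; in the trivial group it is,
hence the witness `γ`. -/
theorem ne_one_of_isMaximalCyclic {γ g : Γ} (hγ : γ ≠ 1)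
    (hC : IsMaximalCyclic (Subgroup.zpowers g)) : g ≠ 1 := by
  rintro rfl
  have hle : Subgroup.zpowers (1 : Γ) ≤ Subgroup.zpowers γ := by simp
  have hcyc : IsCyclic (Subgroup.zpowers γ) := inferInstance
  have := hC.le_of_ge hcyc hle (Subgroup.mem_zpowers γ)
  rw [Subgroup.zpowers_one_eq_bot, Subgroup.mem_bot] at this
  exact hγ this

/-- Each `Z_lam(C)` is a tube. -/
theorem exists_cylinder_eq_tube (hD : ∀ g : Γ, g ≠ 1 → Nonempty (ScrewData g.1)) (hlam : 0 < lam)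
    {γ : Γ} (hγ : γ ≠ 1) {C : Subgroup Γ} (hC : C ∈ shortCyclic Γ lam) :
    ∃ (τ : HypSpace ≃ᵢ HypSpace) (S : Matrix (Fin 4) (Fin 4) ℝ) (κ : ℝ), 0 < κ ∧
      (∀ x, (τ x).1 = S *ᵥ x.1) ∧ cylinder Γ lam C = {x | axisSq (τ x).1 < κ} := by
  obtain ⟨hmax, g, rfl, hlt⟩ := hC
  obtain ⟨D⟩ := hD g (ne_one_of_isMaximalCyclic hγ hmax)
  have : Nonempty HypSpace := ⟨ofSpatial 0⟩
  obtain ⟨x, hx⟩ := exists_lt_of_ciInf_lt hlt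
  obtain ⟨κ, hκ, h⟩ := D.exists_tube hlam ⟨x, 1, one_ne_zero, by rw [zpow_one]; exact hx⟩
  exact ⟨D.τ, D.S, κ, hκ, D.τ_eq, (cylinder_zpowers D).trans h⟩

/-- The family of cylinders is locally finite. -/
theorem finite_setOf_cylinder_inter_ball (hd : DiscreteTopology Γ)
    (hc : CompactSpace (MulAction.orbitRel.Quotient Γ HypSpace))
    (hD : ∀ g : Γ, g ≠ 1 → Nonempty (ScrewData g.1)) (P : HypSpace) :
    {C : shortCyclic Γ lam | (cylinder Γ lam C.1 ∩ Metric.ball P 1).Nonempty}.Finite := by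
  choose M hM using exists_forall_dist_le hd hc
  let Φ : Set Γ := {γ | dist P (γ.1 P) ≤ lam + 2}
  -- A cylinder meeting the ball provides `γ = g ^ n` in the finite set `Φ`. The chosen minimal
  -- point `M γ` lies on the axis of the generator `g`, which moves it no further than `γ` does,
  -- leaving finitely many `g` for each `γ`.
  have hG : (⋃ γ ∈ Φ, {g : Γ | dist (M γ) (g.1 (M γ)) ≤ dist (M γ) (γ.1 (M γ))}).Finite :=
    (finite_setOf_dist_le hd P _).biUnion fun γ _ => finite_setOf_dist_le hd _ _
  refine Set.Finite.of_finite_image ((hG.image Subgroup.zpowers).subset ?_)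
    Subtype.val_injective.injOn
  rintro _ ⟨⟨C, hmax, g, rfl, -⟩, ⟨Q, ⟨h, ⟨n, rfl⟩, hne, hlt⟩, hQ⟩, rfl⟩
  have hg : g ≠ 1 := fun h => hne (by simp [h])
  have hn : n ≠ 0 := by rintro rfl; exact hne (zpow_zero g)
  obtain ⟨D⟩ := hD g hg
  refine ⟨g, Set.mem_iUnion₂.2 ⟨g ^ n, ?_, ?_⟩, rfl⟩
  · change dist P ((g ^ n).1 P) ≤ lam + 2
    have t := dist_triangle4 P Q ((g ^ n).1 Q) ((g ^ n).1 P)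
    rw [(g ^ n).1.isometry.dist_eq, dist_comm P Q] at t
    rw [Metric.mem_ball] at hQ
    change dist Q ((g ^ n).1 Q) < lam at hlt
    linarith
  · exact D.dist_le_of_isMin hn (hM (g ^ n))

end HypSpace

/-! ### The theorem, by passage to cones -/

open HypSpace PreAbstractSimplicialComplex

theorem mainTheorem2 (Γ : Subgroup (HypSpace ≃ᵢ HypSpace))
    (horient : Γ ≤ HypSpace.isomPlus)
    (hdiscrete : DiscreteTopology Γ)
    (htorsion : ∀ g : Γ, g ≠ 1 → ¬ IsOfFinOrder g)
    (hcocompact : CompactSpace (MulAction.orbitRel.Quotient Γ HypSpace))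
    (lam : ℝ) (hlam : 0 < lam) (m : ℕ) (hm : 0 < m)
    (hrank : ∀ P : HypSpace, (m : ℕ∞) ≤ internalRank (HypSpace.shortAt Γ lam P)) :
    ((∀ C ∈ HypSpace.shortCyclic Γ lam, HypSpace.IsCylinder (HypSpace.cylinder Γ lam C)) ∧
      ⋃ C ∈ HypSpace.shortCyclic Γ lam, HypSpace.cylinder Γ lam C = Set.univ) ∧
    ContractibleSpace (HypSpace.cylinderNerve Γ lam).Realization ∧
    (∀ σ ∈ (HypSpace.cylinderNerveLow Γ lam (m - 1)).faces,
      ContractibleSpace ((HypSpace.cylinderNerve Γ lam).link σ).Realization) ∧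
    ContractibleSpace
      ↥((HypSpace.cylinderNerve Γ lam).realizationOf
        (HypSpace.cylinderNerveLow Γ lam (m - 1)))ᶜ := by
  have hD : ∀ g : Γ, g ≠ 1 → Nonempty (ScrewData g.1) := fun g hg =>
    nonempty_screwData horient hdiscrete htorsion hcocompact hg
  have hcov : ∀ P, ∃ C ∈ shortCyclic Γ lam, P ∈ cylinder Γ lam C := by
    intro P
    -- The empty set has internal rank `0`, so `0 < m` makes the cylinders cover.
    have : (shortAt Γ lam P).Nonempty := by
      by_contra hempty
      have h := hrank P
      rw [Set.not_nonempty_iff_eq_empty.1 hempty, internalRank_empty] at h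
      exact hm.ne' (by simpa using h)
    obtain ⟨C, hC⟩ := this
    exact ⟨C, shortAt_subset_shortCyclic hD P hC, hC.2⟩
  obtain ⟨γ, hγ⟩ : ∃ γ : Γ, γ ≠ 1 := by
    obtain ⟨C, -, γ, -, hγ, -⟩ := hcov (ofSpatial 0)
    exact ⟨γ, hγ⟩
  have htube := fun C (hC : C ∈ shortCyclic Γ lam) => exists_cylinder_eq_tube hD hlam hγ hC
  have hcyl : ∀ C ∈ shortCyclic Γ lam, IsCylinder (cylinder Γ lam C) := fun C hC => by
    obtain ⟨τ, S, κ, hκ, -, h⟩ := htube C hC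
    rw [h]; exact isCylinder_tube τ hκ
  let U : shortCyclic Γ lam → Set (Fin 4 → ℝ) := fun C => coneOver (cylinder Γ lam C.1)
  have hopen : ∀ C, IsOpen (U C) := fun C => by
    obtain ⟨L, -, r, -, h⟩ := hcyl C.1 C.2
    exact isOpen_coneOver (h ▸ Metric.isOpen_thickening)
  have hconv : ∀ C, Convex ℝ (U C) := fun C => by
    obtain ⟨τ, S, κ, hκ, hS, h⟩ := htube C.1 C.2
    simp only [U, h]
    exact convex_coneOver_tube hS hκ
  have hunion : ⋃ C, U C = futureCone := by
    refine subset_antisymm (Set.iUnion_subset fun C x hx => hx.1) fun x hx => ?_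
    obtain ⟨C, hC, hxC⟩ := hcov (radialProj ⟨x, hx⟩)
    exact Set.mem_iUnion.2 ⟨⟨C, hC⟩, hx, hxC⟩
  have hX : Convex ℝ (⋃ C, U C) := hunion ▸ convex_futureCone
  have hne : (⋃ C, U C).Nonempty := hunion ▸ ⟨_, coe_mem_futureCone (ofSpatial 0)⟩
  have hfin : ∀ x ∈ ⋃ C, U C, ∃ t ∈ 𝓝 x, {C | (U C ∩ t).Nonempty}.Finite := fun x hx => by
    rw [hunion] at hx
    refine ⟨coneOver (Metric.ball (radialProj ⟨x, hx⟩) 1),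
      (isOpen_coneOver Metric.isOpen_ball).mem_nhds ⟨hx, Metric.mem_ball_self one_pos⟩,
      (finite_setOf_cylinder_inter_ball hdiscrete hcocompact hD
        (radialProj ⟨x, hx⟩)).subset ?_⟩
    rintro C ⟨y, ⟨_, h1⟩, ⟨_, h2⟩⟩
    exact ⟨_, h1, h2⟩
  have hnerve : cylinderNerve Γ lam = nerve U := (nerve_coneOver _).symm
  -- the members of the cover through a point have large internal rank
  have hlarge : ∀ x ∈ futureCone, ∀ s : Finset (shortCyclic Γ lam), (∀ C, x ∈ U C → C ∈ s) →
      ¬ internalRank ((fun C : shortCyclic Γ lam => C.1) '' (s : Set (shortCyclic Γ lam))) ≤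
        ((m - 1 : ℕ) : ℕ∞) := by
    intro x hx s hs hle
    have hsub : shortAt Γ lam (radialProj ⟨x, hx⟩) ⊆
        (fun C : shortCyclic Γ lam => C.1) '' (s : Set (shortCyclic Γ lam)) := fun C hC =>
      ⟨⟨C, shortAt_subset_shortCyclic hD _ hC⟩, hs _ ⟨hx, hC.2⟩, rfl⟩
    have := Nat.cast_le.1 (((hrank _).trans (internalRank_mono hsub)).trans hle)
    -- The truncated subtraction matters here: `m ≤ m - 1` is absurd only because `0 < m`.
    omega
  refine ⟨⟨hcyl, ?_⟩, ?_, fun σ hσ => ?_, ?_⟩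
  · refine Set.eq_univ_of_forall fun P => ?_
    obtain ⟨C, hC, hP⟩ := hcov P
    exact Set.mem_iUnion₂.2 ⟨C, hC, hP⟩
  · rw [hnerve]
    exact contractibleSpace_nerve hopen hconv hX hne hfin
  · have hσK : σ ∈ (nerve U).faces := hnerve ▸ hσ.1
    rw [hnerve]
    refine contractibleSpace_link_nerve hopen hconv hfin hσK fun x hx => ?_
    -- Otherwise all members through `x` belong to `σ`, whose rank would be at least `m`.
    by_contra! hcon
    obtain ⟨i, hi⟩ := hσK.1
    refine hlarge x (Set.mem_iInter₂.1 hx i hi).1 σ (fun C hC => ?_) hσ.2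
    by_contra h
    exact hcon C h hC
  · rw [compl_realizationOf, cylinderNerveLow, hnerve]
    refine contractibleSpace_openPart_nerve hopen hconv hX hne hfin (isUpperFaces_diff _ _)
      fun x hx s hs => ⟨?_, fun h => ?_⟩
    · obtain ⟨i, hi⟩ := Set.mem_iUnion.1 hx
      exact ⟨⟨i, (hs i).2 hi⟩, x, Set.mem_iInter₂.2 fun j hj => (hs j).1 hj⟩
    · exact hlarge x (hunion ▸ hx) s (fun C hC => (hs C).2 hC) h.2
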